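/- Let $s\in(1/2,1)$, $\mu_1,\mu_2,\beta>0$, $r_1,r_2>1$, put $2_s:=\frac{2(1+s)}{1-s}$ and assume $$\frac{2(1+3s)}{1+s}<p,\ q,\ r_1+r_2<2_s .$$ Let $\mathcal H^{1,s}(\mathbb R^2)$ be the space of all real $u\in L^2(\mathbb R^2)$ such that $\partial_x u\in L^2(\mathbb R^2)$ and $(-\Delta)_y^{s/2}u\in L^2(\mathbb R^2)$ in the weak sense, where for test functions $$(-\Delta)_y^{s/2}\varphi(x,y)=C_s\,\mathrm{P.V.}\!\int_{\mathbb R}\frac{\varphi(x,y)-\varphi(x,z)}{|y-z|^{1+s}}\,dz,\qquad C_s=\Big(\int_{\mathbb R}\frac{1-\cos h}{|h|^{1+s}}\,dh\Big)^{-1}.$$ Write $K(u)=\int_{\mathbb R^2}\big(|\partial_xu|^2+|(-\Delta)_y^{s/2}u|^2\big)\,dx\,dy$ and, for $u,v\in\mathcal H^{1,s}(\mathbb R^2)$, $$J(u,v)=\tfrac12K(u)+\tfrac12K(v)-\tfrac{\mu_1}{p}\int_{\mathbb R^2}|u|^p-\tfrac{\mu_2}{q}\int_{\mathbb R^2}|v|^q-\beta\int_{\mathbb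 R^2}|u|^{r_1}|v|^{r_2},$$ $$P(u,v)=sK(u)+sK(v)-\tfrac{(1+s)(p-2)}{2p}\mu_1\int_{\mathbb R^2}|u|^p-\tfrac{(1+s)(q-2)}{2q}\mu_2\int_{\mathbb R^2}|v|^q-\tfrac{(1+s)(r_1+r_2-2)}{2}\beta\int_{\mathbb R^2}|u|^{r_1}|v|^{r_2}.$$ For $a,b>0$ let $D_a=\{u\in\mathcal H^{1,s}(\mathbb R^2):\|u\|_2^2\le a\}$, $$\mathcal P_{(a,b)}=\{(u,v)\in D_a\times D_b:\ (u,v)\neq(0,0),\ P(u,v)=0\},\qquad C_{(a,b)}=\inf_{\mathcal P_{(a,b)}}J,$$ and for $t>0$ let $u_t(x,y)=t^{\frac{1+s}{2}}u(t^sx,ty)$, and likewise $v_t$. Then for all $a,b>0$, the maximum $\max_{t>0}J(u_t,v_t)$ is attained for every $(0,0)\ne(u,v)\in D_a\times D_b$, the two infima below are taken over nonempty sets of real numbers that are bounded below, and $$C_{(a,b)}=\inf_{(0,0)\neq(u,v)\in D_a\times D_b}\ \max_{t>0}J(u_t,v_t)>0 .$$ -/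

import Mathlib

open MeasureTheory Set
open scoped ContDiff

noncomputable section

namespace MixedSchrodinger

/-- Test functions on the plane: smooth with compact support. -/
def IsTest (φ : ℝ × ℝ → ℝ) : Prop :=
  ContDiff ℝ ∞ φ ∧ HasCompactSupport φ

/-- The normalizing constant of the one-dimensional fractional Laplacian of order `s`, i.e. of
`(-Δ)^{s/2}`: the one for which this operator has Fourier symbol `|η|^s`. -/
def fracConst (s : ℝ) : ℝ :=
  (∫ h : ℝ, (1 - Real.cos h) / |h| ^ (1 + s))⁻¹

/-- The pointwise operator `(-Δ)_y^{s/2} φ (x, y) = C_s P.V. ∫_ℝ (φ(x,y) - φ(x,z)) / |y-z|^{1+s} dz`.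
It is used only for test functions `φ` and `0 < s < 1`; there the integral converges absolutely,
so that it coincides with its principal value. -/
def fracLapY (s : ℝ) (φ : ℝ × ℝ → ℝ) (w : ℝ × ℝ) : ℝ :=
  fracConst s * ∫ z : ℝ, (φ w - φ (w.1, z)) / |w.2 - z| ^ (1 + s)

/-- `g` is the weak derivative `∂_x u`. -/
def IsWeakDx (u g : ℝ × ℝ → ℝ) : Prop :=
  ∀ φ : ℝ × ℝ → ℝ, IsTest φ →
    ∫ w, u w * fderiv ℝ φ w (1, 0) = - ∫ w, g w * φ w

/-- `g` is the weak (distributional) fractional Laplacian `(-Δ)_y^{s/2} u`. -/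
def IsWeakFracY (s : ℝ) (u g : ℝ × ℝ → ℝ) : Prop :=
  ∀ φ : ℝ × ℝ → ℝ, IsTest φ →
    ∫ w, u w * fracLapY s φ w = ∫ w, g w * φ w

/-- The fractional Sobolev-Liouville space `H^{1,s}(ℝ²)`: real functions `u ∈ L²` whose weak
`∂_x u` and `(-Δ)_y^{s/2} u` are in `L²`. Its elements are represented by functions; everything
below depends only on their almost-everywhere classes. -/
def MemH (s : ℝ) (u : ℝ × ℝ → ℝ) : Prop :=
  MemLp u 2 ∧ (∃ g, MemLp g 2 ∧ IsWeakDx u g) ∧ (∃ g, MemLp g 2 ∧ IsWeakFracY s u g)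

/-- Two `L²` functions with the same integrals against all test functions agree almost everywhere;
hence the weak derivatives below do not depend on the choice made. -/
theorem ae_eq_of_test {g g' : ℝ × ℝ → ℝ} (hg : MemLp g 2) (hg' : MemLp g' 2)
    (h : ∀ φ, IsTest φ → ∫ w, g w * φ w = ∫ w, g' w * φ w) : g =ᵐ[volume] g' := by
  have hl : LocallyIntegrable g := hg.locallyIntegrable (by norm_num)
  have hl' : LocallyIntegrable g' := hg'.locallyIntegrable (by norm_num)
  refine ae_eq_of_integral_contDiff_smul_eq hl hl' fun φ hφ hc => ?_
  have := h φ ⟨hφ, hc⟩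
  simpa only [smul_eq_mul, mul_comm] using this

open Classical in
/-- The `L²` weak derivative `∂_x u` (and `0` if there is none). -/
def weakDx (u : ℝ × ℝ → ℝ) : ℝ × ℝ → ℝ :=
  if h : ∃ g, MemLp g 2 ∧ IsWeakDx u g then h.choose else 0

open Classical in
/-- The `L²` weak fractional Laplacian `(-Δ)_y^{s/2} u` (and `0` if there is none). -/
def weakFracY (s : ℝ) (u : ℝ × ℝ → ℝ) : ℝ × ℝ → ℝ :=
  if h : ∃ g, MemLp g 2 ∧ IsWeakFracY s u g then h.choose else 0

theorem weakDx_ae_eq {u g : ℝ × ℝ → ℝ} (hg : MemLp g 2) (h : IsWeakDx u g) :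
    weakDx u =ᵐ[volume] g := by
  have hex : ∃ g, MemLp g 2 ∧ IsWeakDx u g := ⟨g, hg, h⟩
  rw [weakDx, dif_pos hex]
  refine ae_eq_of_test hex.choose_spec.1 hg fun φ hφ => ?_
  have h1 := hex.choose_spec.2 φ hφ
  have h2 := h φ hφ
  linarith

theorem weakFracY_ae_eq {s : ℝ} {u g : ℝ × ℝ → ℝ} (hg : MemLp g 2) (h : IsWeakFracY s u g) :
    weakFracY s u =ᵐ[volume] g := by
  have hex : ∃ g, MemLp g 2 ∧ IsWeakFracY s u g := ⟨g, hg, h⟩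
  rw [weakFracY, dif_pos hex]
  refine ae_eq_of_test hex.choose_spec.1 hg fun φ hφ => ?_
  have h1 := hex.choose_spec.2 φ hφ
  have h2 := h φ hφ
  linarith

/-- `∫ (|∂_x u|² + |(-Δ)_y^{s/2} u|²)`. -/
def kinetic (s : ℝ) (u : ℝ × ℝ → ℝ) : ℝ :=
  ∫ w, (|weakDx u w| ^ 2 + |weakFracY s u w| ^ 2)

/-- The real parameters of the system: data only, no assumption. -/
structure Coeffs where
  s : ℝ
  μ₁ : ℝ
  μ₂ : ℝ
  β : ℝ
  p : ℝ
  q : ℝ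
  r₁ : ℝ
  r₂ : ℝ

/-- Pairs `(u, v)` of real functions on the plane. -/
abbrev Pair := (ℝ × ℝ → ℝ) × (ℝ × ℝ → ℝ)

/-- The energy functional `J(u, v)`. -/
def energy (c : Coeffs) (w : Pair) : ℝ :=
  1 / 2 * kinetic c.s w.1 + 1 / 2 * kinetic c.s w.2
    - c.μ₁ / c.p * (∫ z, |w.1 z| ^ c.p)
    - c.μ₂ / c.q * (∫ z, |w.2 z| ^ c.q)
    - c.β * (∫ z, |w.1 z| ^ c.r₁ * |w.2 z| ^ c.r₂)

/-- The Pohozaev functional `P(u, v)`. -/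
def pohozaev (c : Coeffs) (w : Pair) : ℝ :=
  c.s * kinetic c.s w.1 + c.s * kinetic c.s w.2
    - (1 + c.s) * (c.p - 2) / (2 * c.p) * c.μ₁ * (∫ z, |w.1 z| ^ c.p)
    - (1 + c.s) * (c.q - 2) / (2 * c.q) * c.μ₂ * (∫ z, |w.2 z| ^ c.q)
    - (1 + c.s) * (c.r₁ + c.r₂ - 2) / 2 * c.β * (∫ z, |w.1 z| ^ c.r₁ * |w.2 z| ^ c.r₂)

/-- The set `D_a` of all `u ∈ H^{1,s}(ℝ²)` with `‖u‖₂² ≤ a`. -/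
def massBall (s a : ℝ) : Set (ℝ × ℝ → ℝ) :=
  {u | MemH s u ∧ ∫ z, u z ^ 2 ≤ a}

/-- `(D_a × D_b) \ {(0, 0)}`, where functions vanishing almost everywhere are zero. -/
def nonzeroPairs (s a b : ℝ) : Set Pair :=
  {w | w ∈ massBall s a ×ˢ massBall s b ∧ ¬ (w.1 =ᵐ[volume] 0 ∧ w.2 =ᵐ[volume] 0)}

/-- `P_(a,b)`, the part of the Pohozaev manifold in `D_a × D_b`. -/
def pohozaevSet (c : Coeffs) (a b : ℝ) : Set Pair :=
  {w | w ∈ nonzeroPairs c.s a b ∧ pohozaev c w = 0}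

/-- `C_(a,b)`, the infimum of `J` over `P_(a,b)`. -/
def groundLevel (c : Coeffs) (a b : ℝ) : ℝ :=
  sInf (energy c '' pohozaevSet c a b)

/-- The fiber map `u_t(x, y) = t^{(1+s)/2} u(t^s x, t y)`. -/
def dilate (s t : ℝ) (u : ℝ × ℝ → ℝ) : ℝ × ℝ → ℝ :=
  fun z => t ^ ((1 + s) / 2) * u (t ^ s * z.1, t * z.2)

/-- `t ↦ J(u_t, v_t)`. -/
def fiberEnergy (c : Coeffs) (w : Pair) (t : ℝ) : ℝ :=
  energy c (dilate c.s t w.1, dilate c.s t w.2)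

/-- `max_{t > 0} J(u_t, v_t)`, written as a supremum. -/
def fiberMax (c : Coeffs) (w : Pair) : ℝ :=
  sSup (fiberEnergy c w '' Ioi 0)

end MixedSchrodinger

end

noncomputable section

namespace MixedSchrodinger

open Filter Topology

set_option linter.unusedSectionVars false

/-! Along a fiber the energy is `½ t^{2s} K - Σ t^{e_i} A_i`, where `K > 0` is the total kinetic
energy, the `A_i ≥ 0` are the three interaction energies and `e = (1+s)(p-2)/2` for each exponent
`p`. The lower bound on the exponents says exactly that `e_i > 2s`. In the variable `t^{2s}` this is
a linear function minus convex powers, so a critical point is a global maximum. One exists because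
`A₁` or `A₂` is positive. The functional `P` is the derivative at `t = 1`, so each fiber meets the
Pohozaev set at its maximum, and on that set `J` equals its own fiber maximum. Both infima are
therefore taken over the same set of numbers (`image_fiberMax_eq`).

For positivity, `P = 0` gives `J ≥ (1/2 - s/m) K` with `m = min e_i > 2s`, and the
Gagliardo–Nirenberg inequality bounds each `A_i` on `D_a × D_b` by a constant times `K^{e_i/(2s)}`.
These powers exceed `1`, so `P = 0` keeps `K` away from `0`.

Gagliardo–Nirenberg follows by dilation from the embedding of `H^{1,s}` in `Lᵖ`, `2 < p < 2_s`,
which is the analytic core (`exists_eLpNorm_le`). Average `u` over boxes of half-sides `ε` and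
`ε^{1/s}`. The `L²` error is `O(ε)`, while the averaging maps `L²` to `L^∞` with norm at most
`ε^{-κ}`, `κ = (1+1/s)/2`. Along `ε = 2^{-k}`, interpolation makes the `Lᵖ` norms of the increments
decay geometrically precisely when `p < 2_s`.

The `L²` error in `y` must come from the weak fractional Laplacian alone. No Fourier transform is
used: for translations `U_h`, the operators `(1 - U_h) + (1 - U_{-h})` are commuting and positive,
so `‖∫ a(h) (1 - U_h) u dh‖` is monotone in the even kernel `a ≥ 0` (`norm_integral_diff_le`). The
indicator of `[-r, r]`, which gives the average, is then compared with the singular kernel `r^{1+s}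
|h|^{-1-s}`. -/

/-- This is the common majorant of the singular integrals: `s < 1` handles the origin, `s > 0`
handles infinity. -/
theorem integrable_kernel {s : ℝ} (hs : 0 < s) (hs' : s < 1) :
    Integrable fun h : ℝ => |h| ^ (-(1 + s)) * min 1 |h| := by
  have hI : IntegrableOn (fun h : ℝ => h ^ (-(1 + s)) * min 1 h) (Ioi 0) := by
    rw [← Ioc_union_Ioi_eq_Ioi zero_le_one]
    refine IntegrableOn.union ?_ ?_
    · have : IntegrableOn (fun h : ℝ => h ^ (-s)) (Ioc 0 1) :=
        (intervalIntegrable_iff_integrableOn_Ioc_of_le zero_le_one).1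
          (intervalIntegral.intervalIntegrable_rpow' (by linarith))
      refine this.congr_fun (fun h hh => ?_) measurableSet_Ioc
      simp only
      rw [min_eq_right hh.2, ← Real.rpow_add_one hh.1.ne']; congr 1; ring
    · refine (integrableOn_Ioi_rpow_of_lt (a := -(1 + s)) (by linarith) zero_lt_one).congr_fun
        (fun h hh => ?_) measurableSet_Ioi
      simp only
      rw [min_eq_left (le_of_lt hh), mul_one]
  have hp : IntegrableOn (fun h : ℝ => |h| ^ (-(1 + s)) * min 1 |h|) (Ioi 0) :=
    hI.congr_fun (fun h hh => by simp only [abs_of_pos (mem_Ioi.1 hh)]) measurableSet_Ioi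
  have hn : IntegrableOn (fun h : ℝ => |h| ^ (-(1 + s)) * min 1 |h|) (Iio 0) := by
    have := hp.comp_neg
    simpa using this
  have := hn.union ((integrableOn_Ici_iff_integrableOn_Ioi).2 hp)
  rwa [Iio_union_Ici, integrableOn_univ] at this

/-! ### Isometry groups: differences, symmetric averages, kernel comparison -/

/-- A strongly continuous one-parameter group of linear isometries of a real inner product space. -/
structure IsometryFlow (H : Type*) [NormedAddCommGroup H] [InnerProductSpace ℝ H] where
  /-- The isometry at time `t`. -/
  map : ℝ → H →ₗᵢ[ℝ] H
  map_zero : ∀ u, map 0 u = u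
  map_add : ∀ s t u, map (s + t) u = map s (map t u)
  continuous_map : ∀ u, Continuous fun t => map t u

namespace IsometryFlow

variable {H : Type*} [NormedAddCommGroup H] [InnerProductSpace ℝ H] (U : IsometryFlow H)

theorem map_comm (s t : ℝ) (u : H) : U.map s (U.map t u) = U.map t (U.map s u) := by
  rw [← U.map_add, ← U.map_add, add_comm]

theorem inner_map (t : ℝ) (u v : H) : inner ℝ (U.map t u) v = inner ℝ u (U.map (-t) v) := by
  rw [← (U.map (-t)).inner_map_map, ← U.map_add, neg_add_cancel, U.map_zero]

/-- The difference operator `1 - U_h`. -/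
def diff (h : ℝ) (u : H) : H := u - U.map h u

theorem continuous_diff (u : H) : Continuous fun h => U.diff h u :=
  continuous_const.sub (U.continuous_map u)

theorem norm_diff_le (h : ℝ) (u : H) : ‖U.diff h u‖ ≤ 2 * ‖u‖ := by
  have := norm_sub_le u (U.map h u)
  rw [(U.map h).norm_map] at this
  simp only [diff]; linarith

theorem inner_diff (h : ℝ) (u v : H) :
    inner ℝ (U.diff h u) v = inner ℝ u (U.diff (-h) v) := by
  simp only [diff, inner_sub_left, inner_sub_right, U.inner_map]

theorem diff_comm (h k : ℝ) (u : H) : U.diff h (U.diff k u) = U.diff k (U.diff h u) := by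
  simp only [diff, map_sub, U.map_comm k h]; abel

theorem map_diff (h t : ℝ) (u : H) : U.map t (U.diff h u) = U.diff h (U.map t u) := by
  simp only [diff, map_sub, U.map_comm t h]

theorem diff_add_diff_neg (h : ℝ) (u : H) :
    U.diff h u + U.diff (-h) u = U.diff (-h) (U.diff h u) := by
  simp only [diff, map_sub, ← U.map_add, neg_add_cancel, U.map_zero]; abel

/-- With `D_h = 1 - U_h`, the symmetric difference is `D_{-h} D_h`, and `D_{-h}` is the adjoint of
`D_h`. Since all these operators commute, the inner product is `‖D_k D_h u‖²`. -/
theorem inner_symm_diff_nonneg (h k : ℝ) (u : H) :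
    0 ≤ inner ℝ (U.diff h u + U.diff (-h) u) (U.diff k u + U.diff (-k) u) := by
  have : inner ℝ (U.diff h u + U.diff (-h) u) (U.diff k u + U.diff (-k) u)
      = inner ℝ (U.diff k (U.diff h u)) (U.diff k (U.diff h u)) := by
    rw [diff_add_diff_neg, diff_add_diff_neg, inner_diff, neg_neg, U.diff_comm h (-k),
      ← neg_neg k, ← inner_diff, neg_neg, U.diff_comm h k]
  rw [this]; exact real_inner_self_nonneg

variable [CompleteSpace H]

/-- An even kernel allows each difference to be symmetrized, which makes the integrands positive
operators. -/
theorem integral_diff_eq {a : ℝ → ℝ} (heven : ∀ h, a (-h) = a h) {u : H}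
    (hi : Integrable fun h => a h • U.diff h u) :
    Integrable (fun h => a h • (U.diff h u + U.diff (-h) u)) ∧
    ∫ h, a h • (U.diff h u + U.diff (-h) u) = (2 : ℝ) • ∫ h, a h • U.diff h u := by
  have hi' : Integrable fun h => a h • U.diff (-h) u := by
    have := hi.comp_neg
    simpa only [heven] using this
  have he : ∫ h, a h • U.diff (-h) u = ∫ h, a h • U.diff h u := by
    rw [← integral_neg_eq_self]
    simp only [heven, neg_neg]
  simp only [smul_add]
  exact ⟨hi.add hi', by rw [integral_add hi hi', he, two_smul]⟩

/-- Write the larger integral as `x + y`, with `x` the smaller one and `y` the integral against `b -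
a ≥ 0`. As a double integral of nonnegative inner products, `⟨x, y⟩ ≥ 0`, hence `‖x + y‖ ≥ ‖x‖`. -/
theorem norm_integral_diff_le {a b : ℝ → ℝ} (ha : ∀ h, a (-h) = a h) (hb : ∀ h, b (-h) = b h)
    (h0 : ∀ h, 0 ≤ a h) (hab : ∀ h, a h ≤ b h) {u : H}
    (hia : Integrable fun h => a h • U.diff h u) (hib : Integrable fun h => b h • U.diff h u) :
    ‖∫ h, a h • U.diff h u‖ ≤ ‖∫ h, b h • U.diff h u‖ := by
  obtain ⟨ia, ea⟩ := U.integral_diff_eq ha hia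
  have hic : Integrable fun h => (b h - a h) • U.diff h u := by
    simp only [sub_smul]; exact hib.sub hia
  obtain ⟨ic, ec⟩ := U.integral_diff_eq (a := fun h => b h - a h) (by simp [ha, hb]) hic
  have key : 0 ≤ inner ℝ (∫ h, a h • (U.diff h u + U.diff (-h) u))
      (∫ h, (b h - a h) • (U.diff h u + U.diff (-h) u)) := by
    rw [← integral_inner ic]
    refine integral_nonneg fun k => ?_
    simp only [Pi.zero_apply]
    rw [inner_smul_right]
    refine mul_nonneg (by linarith [hab k]) ?_
    rw [real_inner_comm, ← integral_inner ia]
    refine integral_nonneg fun h => ?_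
    simp only [Pi.zero_apply]
    rw [inner_smul_right]
    exact mul_nonneg (h0 h) (U.inner_symm_diff_nonneg _ _ _)
  rw [ea, ec, inner_smul_left, inner_smul_right] at key
  have e : ∫ h, b h • U.diff h u
      = (∫ h, a h • U.diff h u) + ∫ h, (b h - a h) • U.diff h u := by
    rw [← integral_add hia hic]; congr 1; ext h; rw [← add_smul]; congr 1; ring
  rw [e]
  set x := ∫ h, a h • U.diff h u
  set y := ∫ h, (b h - a h) • U.diff h u
  have h1 := norm_add_sq_real x y
  have : 0 ≤ inner ℝ x y := by simp at key; exact key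
  exact abs_le_of_sq_le_sq' (by nlinarith [sq_nonneg ‖y‖]) (norm_nonneg _) |>.2

/-- The symmetric average `(2r)⁻¹ ∫_{-r}^r U_t dt`. -/
def avg (r : ℝ) : H →L[ℝ] H :=
  LinearMap.mkContinuous
    { toFun := fun u => (2 * r)⁻¹ • ∫ t in (-r)..r, U.map t u
      map_add' := fun u v => by
        simp only [_root_.map_add]
        rw [intervalIntegral.integral_add ((U.continuous_map u).intervalIntegrable _ _)
          ((U.continuous_map v).intervalIntegrable _ _), smul_add]
      map_smul' := fun c u => by
        simp only [map_smul, intervalIntegral.integral_smul, RingHom.id_apply]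
        rw [smul_comm] } 1 fun u => by
    simp only [LinearMap.coe_mk, AddHom.coe_mk]
    have h := intervalIntegral.norm_integral_le_of_norm_le_const (a := -r) (b := r)
      (f := fun t => U.map t u) (C := ‖u‖) fun t _ => ((U.map t).norm_map u).le
    rw [norm_smul, norm_inv, Real.norm_eq_abs]
    have e : r - -r = 2 * r := by ring
    rw [e] at h
    -- At `r = 0` the convention `0⁻¹ = 0` makes the average zero.
    rcases eq_or_ne r 0 with rfl | hr
    · simp
    · have : 0 < |2 * r| := by positivity
      rw [inv_mul_le_iff₀ this]; linarith

theorem avg_apply (r : ℝ) (u : H) : U.avg r u = (2 * r)⁻¹ • ∫ t in (-r)..r, U.map t u := rfl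

theorem norm_avg_le (r : ℝ) (u : H) : ‖U.avg r u‖ ≤ ‖u‖ := by
  have : ‖U.avg r u‖ ≤ 1 * ‖u‖ := ContinuousLinearMap.le_of_opNorm_le _
    (LinearMap.mkContinuous_norm_le _ zero_le_one _) u
  linarith

theorem inner_avg (r : ℝ) (u v : H) :
    inner ℝ (U.avg r u) v = (2 * r)⁻¹ * ∫ t in (-r)..r, inner ℝ (U.map t u) v := by
  have := (innerSL ℝ v).intervalIntegral_comp_comm
    ((U.continuous_map u).intervalIntegrable (-r) r) (μ := volume)
  simp only [innerSL_apply_apply] at this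
  rw [avg_apply, real_inner_comm, inner_smul_right, ← this]
  simp only [real_inner_comm v]

theorem sub_avg {r : ℝ} (hr : 0 < r) (u : H) :
    u - U.avg r u = (2 * r)⁻¹ • ∫ t in (-r)..r, U.diff t u := by
  simp only [diff]
  rw [intervalIntegral.integral_sub (by simp) ((U.continuous_map u).intervalIntegrable _ _),
    smul_sub, avg_apply, intervalIntegral.integral_const, smul_smul, sub_neg_eq_add, ← two_mul,
    inv_mul_cancel₀ (by positivity), one_smul]

theorem norm_sub_avg_le {r : ℝ} (hr : 0 < r) {u : H} {C : ℝ}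
    (h : ∀ t ∈ Icc (-r) r, ‖U.diff t u‖ ≤ C) : ‖u - U.avg r u‖ ≤ C := by
  rw [U.sub_avg hr, norm_smul, norm_inv, Real.norm_eq_abs, abs_of_pos (by positivity),
    inv_mul_le_iff₀ (by positivity)]
  refine (intervalIntegral.norm_integral_le_of_norm_le_const (C := C) fun t ht => h t ?_).trans ?_
  · rw [uIoc_of_le (by linarith)] at ht; exact Ioc_subset_Icc_self ht
  · rw [sub_neg_eq_add, ← two_mul, abs_of_pos (by positivity), mul_comm]

theorem tendsto_avg (u : H) : Tendsto (fun r => U.avg r u) (𝓝[>] 0) (𝓝 u) := by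
  rw [Metric.tendsto_nhds]
  intro ε hε
  have h0 : Tendsto (fun t => U.diff t u) (𝓝 0) (𝓝 0) := by
    have := (U.continuous_diff u).tendsto 0
    simpa [diff, U.map_zero] using this
  obtain ⟨d, hd, h⟩ := Metric.tendsto_nhds_nhds.1 h0 (ε / 2) (by positivity)
  filter_upwards [Ioo_mem_nhdsGT hd] with r hr
  rw [dist_comm, dist_eq_norm]
  refine lt_of_le_of_lt (U.norm_sub_avg_le hr.1 (C := ε / 2) fun t ht => ?_) (by linarith)
  have := h (x := t) (by rw [dist_zero_right, Real.norm_eq_abs]; exact (abs_le.2 ht).trans_lt hr.2)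
  rw [dist_zero_right] at this; exact this.le

theorem commute_avg (A : H →L[ℝ] H) (hA : ∀ t u, A (U.map t u) = U.map t (A u)) (r : ℝ) (u : H) :
    A (U.avg r u) = U.avg r (A u) := by
  rw [avg_apply, avg_apply, map_smul]
  congr 1
  rw [← A.intervalIntegral_comp_comm ((U.continuous_map u).intervalIntegrable (-r) r)]
  simp only [hA]

theorem map_avg (r t : ℝ) (u : H) : U.map t (U.avg r u) = U.avg r (U.map t u) :=
  U.commute_avg (U.map t).toContinuousLinearMap (fun s u => U.map_comm t s u) r u

/-- Shifting the window changes the integral only on two end intervals of length `|h|`. Averages of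
arbitrary vectors are thus Lipschitz along the flow, so that singular integrals apply to them. -/
theorem norm_diff_avg_le {r : ℝ} (hr : 0 < r) (h : ℝ) (u : H) :
    ‖U.diff h (U.avg r u)‖ ≤ |h| / r * ‖u‖ := by
  have hi : ∀ a b : ℝ, IntervalIntegrable (fun t => U.map t u) volume a b :=
    fun a b => (U.continuous_map u).intervalIntegrable _ _
  have e1 : U.map h (U.avg r u) = (2 * r)⁻¹ • ∫ t in (-r + h)..(r + h), U.map t u := by
    rw [map_avg, avg_apply]
    simp only [← U.map_add]
    rw [intervalIntegral.integral_comp_add_right (fun t => U.map t u)]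
  have e2 : (∫ t in (-r)..r, U.map t u) - ∫ t in (-r + h)..(r + h), U.map t u
      = (∫ t in (-r)..(-r + h), U.map t u) - ∫ t in r..(r + h), U.map t u := 
    intervalIntegral.integral_interval_sub_interval_comm (hi _ _) (hi _ _) (hi _ _)
  have hb : ∀ a : ℝ, ‖∫ t in a..(a + h), U.map t u‖ ≤ ‖u‖ * |h| := fun a => by
    refine (intervalIntegral.norm_integral_le_of_norm_le_const fun t _ =>
      ((U.map t).norm_map u).le).trans ?_
    rw [add_sub_cancel_left]
  rw [diff, e1, avg_apply, ← smul_sub, e2, norm_smul, norm_inv, Real.norm_eq_abs,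
    abs_of_pos (by positivity), inv_mul_le_iff₀ (by positivity)]
  refine (norm_sub_le _ _).trans ((add_le_add (hb _) (hb _)).trans (le_of_eq ?_))
  field_simp
  ring

theorem integrable_smul_diff {s : ℝ} (hs : 0 < s) (hs' : s < 1) {x : H} {L : ℝ}
    (hL : ∀ h, ‖U.diff h x‖ ≤ L * |h|) :
    Integrable fun h => |h| ^ (-(1 + s)) • U.diff h x := by
  refine ((integrable_kernel hs hs').const_mul (max L (2 * ‖x‖))).mono' ?_
    (Eventually.of_forall fun h => ?_)
  · exact (by fun_prop : Measurable fun h : ℝ => |h| ^ (-(1 + s))).aestronglyMeasurable.smul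
      (U.continuous_diff x).aestronglyMeasurable
  · have h0 : 0 ≤ |h| ^ (-(1 + s)) := by positivity
    rw [norm_smul, Real.norm_eq_abs, abs_of_nonneg h0, mul_left_comm]
    refine mul_le_mul_of_nonneg_left ?_ h0
    rcases le_total 1 |h| with h1 | h1
    · rw [min_eq_left h1, mul_one]
      exact (U.norm_diff_le h x).trans (le_max_right _ _)
    · rw [min_eq_right h1]
      exact (hL h).trans (mul_le_mul_of_nonneg_right (le_max_left _ _) (abs_nonneg _))

/-- The left side is `(2r)⁻¹` times an integral of differences over `[-r, r]`, where `1 ≤ r^{1+s}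
|h|^{-1-s}`. Kernel comparison yields the factor `r^{1+s}/(2r) = r^s/2`. -/
theorem norm_sub_avg_le_integral {s : ℝ} (hs : 0 < s) (hs' : s < 1) {x : H} {L : ℝ}
    (hL : ∀ h, ‖U.diff h x‖ ≤ L * |h|) {r : ℝ} (hr : 0 < r) :
    ‖x - U.avg r x‖ ≤ r ^ s / 2 * ‖∫ h, |h| ^ (-(1 + s)) • U.diff h x‖ := by
  -- The origin is removed because `0 ^ (-(1 + s))` is `0` by convention, so `a ≤ b` would fail
  -- there.
  set a : ℝ → ℝ := (Icc (-r) r \ {0}).indicator 1 with ha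
  set b : ℝ → ℝ := fun h => r ^ (1 + s) * |h| ^ (-(1 + s)) with hb
  have hae : ∀ h, a (-h) = a h := fun h => by
    have : -h ∈ Icc (-r) r \ {0} ↔ h ∈ Icc (-r) r \ {0} := by
      simp only [Set.mem_sdiff, mem_Icc, mem_singleton_iff, neg_eq_zero]
      constructor <;> rintro ⟨⟨h1, h2⟩, h3⟩ <;> exact ⟨⟨by linarith, by linarith⟩, h3⟩
    by_cases hm : h ∈ Icc (-r) r \ {0}
    · rw [ha, indicator_of_mem hm, indicator_of_mem (this.2 hm)]; rfl
    · rw [ha, indicator_of_notMem hm, indicator_of_notMem (mt this.1 hm)]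
  have hsm : ∀ h, a h • U.diff h x = (Icc (-r) r \ {0}).indicator (fun h => U.diff h x) h := by
    intro h
    by_cases hm : h ∈ Icc (-r) r \ {0}
    · simp [ha, indicator_of_mem hm]
    · simp [ha, indicator_of_notMem hm]
  have hms : MeasurableSet (Icc (-r) r \ {0}) := measurableSet_Icc.diff (measurableSet_singleton 0)
  have hia : Integrable fun h => a h • U.diff h x := by
    simp only [hsm]
    rw [integrable_indicator_iff hms]
    exact ((U.continuous_diff x).continuousOn.integrableOn_Icc).mono_set sdiff_subset
  have hib : Integrable fun h => b h • U.diff h x := by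
    simp only [hb, mul_smul]
    exact (U.integrable_smul_diff hs hs' hL).smul (r ^ (1 + s))
  have h1 := U.norm_integral_diff_le hae (b := b) (by simp [hb])
    (fun h => indicator_nonneg (fun _ _ => zero_le_one) _) (fun h => ?_) hia hib
  · have e1 : ∫ h, a h • U.diff h x = ∫ h in (-r)..r, U.diff h x := by
      simp only [hsm]
      rw [integral_indicator hms, intervalIntegral.integral_of_le (by linarith),
        ← integral_Icc_eq_integral_Ioc]
      exact setIntegral_congr_set (sdiff_null_ae_eq_self (measure_singleton 0))
    have e2 : ∫ h, b h • U.diff h x = r ^ (1 + s) • ∫ h, |h| ^ (-(1 + s)) • U.diff h x := by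
      simp only [hb, mul_smul]; rw [integral_smul]
    rw [e1, e2, norm_smul, Real.norm_eq_abs, abs_of_pos (by positivity)] at h1
    rw [U.sub_avg hr, norm_smul, norm_inv, Real.norm_eq_abs, abs_of_pos (by positivity),
      inv_mul_le_iff₀ (by positivity)]
    refine h1.trans (le_of_eq ?_)
    rw [Real.rpow_add hr, Real.rpow_one]; ring
  · by_cases hm : h ∈ Icc (-r) r \ {0}
    · rw [ha, indicator_of_mem hm, hb]
      have h0 : 0 < |h| := abs_pos.2 hm.2
      have : |h| ^ (1 + s) ≤ r ^ (1 + s) :=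
        Real.rpow_le_rpow h0.le (abs_le.2 hm.1) (by linarith)
      simp only [Pi.one_apply]
      rw [Real.rpow_neg h0.le, ← div_eq_mul_inv, le_div_iff₀ (by positivity), one_mul]
      exact this
    · rw [ha, indicator_of_notMem hm]; positivity

/-- A weak fractional Laplacian of order `s` along the flow controls the symmetric averages. -/
theorem norm_sub_avg_le_of_weak {s : ℝ} (hs : 0 < s) (hs' : s < 1) {Φ : Set H} (hd : Dense Φ)
    (hinv : ∀ t, ∀ φ ∈ Φ, U.map t φ ∈ Φ) (hlip : ∀ φ ∈ Φ, ∃ L, ∀ h, ‖U.diff h φ‖ ≤ L * |h|)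
    {u g : H} (hw : ∀ φ ∈ Φ, ∫ h, |h| ^ (-(1 + s)) * inner ℝ u (U.diff h φ) = inner ℝ g φ)
    {r : ℝ} (hr : 0 < r) : ‖u - U.avg r u‖ ≤ r ^ s / 2 * ‖g‖ := by
  -- The singular integral of the differences of `u` itself is not known to converge, so `u` is
  -- first averaged at scale `δ`, which is then sent to `0`.
  have hmoll : ∀ δ > 0, ‖U.avg δ u - U.avg r (U.avg δ u)‖ ≤ r ^ s / 2 * ‖g‖ := by
    intro δ hδ
    have hL : ∀ h, ‖U.diff h (U.avg δ u)‖ ≤ ‖u‖ / δ * |h| := fun h =>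
      (U.norm_diff_avg_le hδ h u).trans (le_of_eq (by ring))
    refine (U.norm_sub_avg_le_integral hs hs' hL hr).trans
      (mul_le_mul_of_nonneg_left ?_ (by positivity))
    -- Tested against `φ`, both the average and the difference move onto `φ`. After Fubini the weak
    -- equation is applied to each translate of `φ`.
    have hG : ∫ h, |h| ^ (-(1 + s)) • U.diff h (U.avg δ u) = U.avg δ g := by
      refine hd.eq_of_inner_right (𝕜 := ℝ) fun φ hφ => ?_
      obtain ⟨L, hLφ⟩ := hlip φ hφ
      have hda : ∀ h, U.diff h (U.avg δ u) = U.avg δ (U.diff h u) := fun h => by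
        simp only [diff, map_avg, map_sub]
      rw [← integral_inner (U.integrable_smul_diff hs hs' hL)]
      have hφL : Integrable (Function.uncurry fun h t : ℝ =>
          |h| ^ (-(1 + s)) * inner ℝ u (U.diff (-h) (U.map (-t) φ)))
          (volume.prod (volume.restrict (Ioc (-δ) δ))) := by
        have hb : Integrable (fun z : ℝ × ℝ => (|z.1| ^ (-(1 + s)) * min 1 |z.1|) *
            (‖u‖ * max L (2 * ‖φ‖))) (volume.prod (volume.restrict (Ioc (-δ) δ))) :=
          (integrable_kernel hs hs').mul_prod (integrable_const (‖u‖ * max L (2 * ‖φ‖)))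
        refine hb.mono' ?_ (Eventually.of_forall fun z => ?_)
        · have hc : Continuous fun z : ℝ × ℝ => inner ℝ u (U.diff (-z.1) (U.map (-z.2) φ)) := by
            simp only [diff, ← U.map_add]
            exact continuous_const.inner (((U.continuous_map φ).comp (by fun_prop)).sub
              ((U.continuous_map φ).comp (by fun_prop)))
          exact (by fun_prop : Measurable fun z : ℝ × ℝ =>
            |z.1| ^ (-(1 + s))).aestronglyMeasurable.mul hc.aestronglyMeasurable
        · have h0 : 0 ≤ |z.1| ^ (-(1 + s)) := by positivity
          rw [Function.uncurry_apply_pair, norm_mul, Real.norm_eq_abs, abs_of_nonneg h0, mul_assoc]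
          refine mul_le_mul_of_nonneg_left ((norm_inner_le_norm _ _).trans ?_) h0
          rw [mul_left_comm]
          refine mul_le_mul_of_nonneg_left ?_ (norm_nonneg u)
          rw [← map_diff, (U.map _).norm_map, mul_comm]
          rcases le_total 1 |z.1| with h1 | h1
          · rw [min_eq_left h1, mul_one]
            exact (U.norm_diff_le _ _).trans (le_max_right _ _)
          · rw [min_eq_right h1]
            refine (hLφ _).trans ?_
            rw [abs_neg]
            exact mul_le_mul_of_nonneg_right (le_max_left _ _) (abs_nonneg _)
      calc ∫ h, inner ℝ φ (|h| ^ (-(1 + s)) • U.diff h (U.avg δ u))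
          = ∫ h, (2 * δ)⁻¹ * ∫ t in Ioc (-δ) δ,
              |h| ^ (-(1 + s)) * inner ℝ u (U.diff (-h) (U.map (-t) φ)) := by
            refine integral_congr_ae (Eventually.of_forall fun h => ?_)
            simp only
            rw [inner_smul_right, real_inner_comm, hda, U.inner_avg,
              intervalIntegral.integral_of_le (by linarith), integral_const_mul, mul_left_comm]
            simp only [U.inner_map, U.inner_diff]
        _ = (2 * δ)⁻¹ * ∫ t in Ioc (-δ) δ, ∫ h,
              |h| ^ (-(1 + s)) * inner ℝ u (U.diff (-h) (U.map (-t) φ)) := by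
            rw [integral_const_mul, integral_integral_swap hφL]
        _ = (2 * δ)⁻¹ * ∫ t in Ioc (-δ) δ, inner ℝ (U.map t g) φ := by
            congr 2; ext t
            rw [U.inner_map, ← hw _ (hinv _ _ hφ), ← integral_neg_eq_self]
            simp only [abs_neg, neg_neg]
        _ = inner ℝ φ (U.avg δ g) := by
            rw [real_inner_comm, U.inner_avg, intervalIntegral.integral_of_le (by linarith)]
    rw [hG]
    exact U.norm_avg_le _ _
  have ht : Tendsto (fun δ => ‖U.avg δ u - U.avg r (U.avg δ u)‖) (𝓝[>] 0)
      (𝓝 ‖u - U.avg r u‖) :=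
    ((U.tendsto_avg u).sub (((U.avg r).continuous.tendsto u).comp (U.tendsto_avg u))).norm
  exact le_of_tendsto ht (eventually_mem_nhdsWithin.mono hmoll)

/-- A weak derivative along the flow controls the differences. -/
theorem norm_diff_le_of_weak {Φ : Set H} (hd : Dense Φ) (hinv : ∀ t, ∀ φ ∈ Φ, U.map t φ ∈ Φ)
    {u g : H} (hw : ∀ φ ∈ Φ, HasDerivAt (fun t => inner ℝ u (U.map t φ)) (-inner ℝ g φ) 0)
    (h : ℝ) : ‖U.diff h u‖ ≤ |h| * ‖g‖ := by
  have hw' : ∀ φ ∈ Φ, ∀ t, HasDerivAt (fun t => inner ℝ u (U.map t φ))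
      (-inner ℝ g (U.map t φ)) t := fun φ hφ t => by
    have h1 := hw _ (hinv t φ hφ)
    rw [← sub_self t] at h1
    have h2 := HasDerivAt.comp_sub_const t t h1
    simpa only [← U.map_add, sub_add_cancel] using h2
  have hb : ∀ φ ∈ Φ, inner ℝ (U.diff h u) φ ≤ |h| * ‖g‖ * ‖φ‖ := fun φ hφ => by
    have := Convex.norm_image_sub_le_of_norm_hasDerivWithin_le (C := ‖g‖ * ‖φ‖) (s := univ)
      (fun t _ => (hw' φ hφ t).hasDerivWithinAt) (fun t _ => by
        rw [norm_neg]
        refine (norm_inner_le_norm _ _).trans (le_of_eq ?_)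
        rw [(U.map t).norm_map]) convex_univ (mem_univ (-h)) (mem_univ 0)
    rw [U.inner_diff, diff, inner_sub_right]
    rw [Real.norm_eq_abs, Real.norm_eq_abs, U.map_zero, sub_neg_eq_add, zero_add] at this
    calc _ ≤ _ := le_abs_self _
      _ ≤ _ := this
      _ = _ := by ring
  have hcl : IsClosed {φ : H | inner ℝ (U.diff h u) φ ≤ |h| * ‖g‖ * ‖φ‖} :=
    isClosed_le (by fun_prop) (by fun_prop)
  -- By density the bound also holds for `φ = U.diff h u`, where it reads `‖φ‖² ≤ |h| ‖g‖ ‖φ‖`.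
  have hall := hcl.closure_subset_iff.2 hb (hd (U.diff h u))
  simp only [mem_ofPred_eq, real_inner_self_eq_norm_sq] at hall
  by_contra! hlt
  have h0 : 0 ≤ |h| * ‖g‖ := by positivity
  nlinarith

theorem norm_sub_avg_le_of_weak_deriv {Φ : Set H} (hd : Dense Φ)
    (hinv : ∀ t, ∀ φ ∈ Φ, U.map t φ ∈ Φ) {u g : H}
    (hw : ∀ φ ∈ Φ, HasDerivAt (fun t => inner ℝ u (U.map t φ)) (-inner ℝ g φ) 0)
    {r : ℝ} (hr : 0 < r) : ‖u - U.avg r u‖ ≤ r * ‖g‖ :=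
  U.norm_sub_avg_le hr fun t ht => (U.norm_diff_le_of_weak hd hinv hw t).trans
    (mul_le_mul_of_nonneg_right (abs_le.2 ht) (norm_nonneg _))

end IsometryFlow

/-! ### Translations and test functions in the plane -/

/-- `L²(ℝ²)`. -/
abbrev PlaneL2 := Lp ℝ 2 (volume : Measure (ℝ × ℝ))

theorem inner_eq_integral {u v : PlaneL2} {f g : ℝ × ℝ → ℝ} (hu : u =ᵐ[volume] f)
    (hv : v =ᵐ[volume] g) : inner ℝ u v = ∫ w, f w * g w := by
  rw [L2.inner_def]
  refine integral_congr_ae ?_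
  filter_upwards [hu, hv] with w h1 h2
  rw [h1, h2]; simp [mul_comm]

theorem integrable_mul_of_ae {u v : PlaneL2} {f g : ℝ × ℝ → ℝ} (hu : u =ᵐ[volume] f)
    (hv : v =ᵐ[volume] g) : Integrable fun w => f w * g w := by
  have hf : MemLp f 2 := (memLp_congr_ae hu).1 (Lp.memLp u)
  have hg : MemLp g 2 := (memLp_congr_ae hv).1 (Lp.memLp v)
  exact hf.integrable_mul hg

theorem integral_abs_mul_abs_le {u v : PlaneL2} {f g : ℝ × ℝ → ℝ} (hu : u =ᵐ[volume] f)
    (hv : v =ᵐ[volume] g) : ∫ w, |f w| * |g w| ≤ ‖u‖ * ‖v‖ := by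
  rw [← inner_eq_integral (u := |u|) (v := |v|)]
  · exact (real_inner_le_norm _ _).trans (by rw [norm_abs_eq_norm, norm_abs_eq_norm])
  · filter_upwards [hu, Lp.coeFn_abs u] with w h1 h2
    rw [h2, h1]
  · filter_upwards [hv, Lp.coeFn_abs v] with w h1 h2
    rw [h2, h1]

theorem norm_sq_eq_integral {u : PlaneL2} {f : ℝ × ℝ → ℝ} (hu : u =ᵐ[volume] f) :
    ‖u‖ ^ 2 = ∫ w, f w ^ 2 := by
  rw [← real_inner_self_eq_norm_sq, inner_eq_integral hu hu]
  simp only [sq]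

/-- Translation on `L²(ℝ²)`. -/
def trans (z : ℝ × ℝ) : PlaneL2 →ₗᵢ[ℝ] PlaneL2 :=
  Lp.compMeasurePreservingₗᵢ ℝ (fun w => w + z) (measurePreserving_add_right volume z)

theorem coeFn_trans (z : ℝ × ℝ) (u : PlaneL2) : trans z u =ᵐ[volume] fun w => u (w + z) :=
  Lp.coeFn_compMeasurePreserving u (measurePreserving_add_right volume z)

theorem trans_ae_eq {u : PlaneL2} {f : ℝ × ℝ → ℝ} (hu : u =ᵐ[volume] f) (z : ℝ × ℝ) :
    trans z u =ᵐ[volume] fun w => f (w + z) :=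
  (coeFn_trans z u).trans
    ((measurePreserving_add_right volume z).quasiMeasurePreserving.ae_eq_comp hu)

theorem trans_zero (u : PlaneL2) : trans 0 u = u := by
  refine Lp.ext ((coeFn_trans 0 u).trans ?_)
  simp

theorem trans_add (y z : ℝ × ℝ) (u : PlaneL2) : trans (y + z) u = trans y (trans z u) := by
  refine Lp.ext ((coeFn_trans _ u).trans ?_)
  refine ((trans_ae_eq (coeFn_trans z u) y).trans (Eventually.of_forall fun w => ?_)).symm
  simp only [add_assoc]

theorem continuous_trans (u : PlaneL2) : Continuous fun z => trans z u := by
  have : Continuous fun z : ℝ × ℝ => (⟨fun w => w + z, by fun_prop⟩ : C(ℝ × ℝ, ℝ × ℝ)) :=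
    ContinuousMap.continuous_of_continuous_uncurry _
      (continuous_snd.add continuous_fst)
  exact Continuous.compMeasurePreservingLp (f := fun _ => u) continuous_const this
    (fun z => measurePreserving_add_right volume z) (by simp)

/-- The translation flow in the direction `e`. -/
def transFlow (e : ℝ × ℝ) : IsometryFlow PlaneL2 where
  map t := trans (t • e)
  map_zero u := by rw [zero_smul, trans_zero]
  map_add s t u := by rw [add_smul, trans_add]
  continuous_map u := (continuous_trans u).comp (by fun_prop)

theorem transFlow_map (e : ℝ × ℝ) (t : ℝ) : (transFlow e).map t = trans (t • e) := rfl

/-- The classes of test functions. -/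
def testClass : Set PlaneL2 := {x | ∃ φ, IsTest φ ∧ x =ᵐ[volume] φ}

theorem dense_testClass : Dense testClass := by
  refine (Lp.dense_hasCompactSupport_contDiff (E := ℝ × ℝ) (F := ℝ) (μ := volume)
    (p := 2) (by simp)).mono ?_
  rintro x ⟨φ, h1, h2, h3⟩
  exact ⟨φ, ⟨h3, h2⟩, h1⟩

theorem IsTest.memLp {φ : ℝ × ℝ → ℝ} (h : IsTest φ) : MemLp φ 2 :=
  h.1.continuous.memLp_of_hasCompactSupport h.2

theorem IsTest.translate {φ : ℝ × ℝ → ℝ} (h : IsTest φ) (z : ℝ × ℝ) :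
    IsTest fun w => φ (w + z) :=
  ⟨h.1.comp (contDiff_id.add contDiff_const), h.2.comp_homeomorph (Homeomorph.addRight z)⟩

theorem trans_mem_testClass (z : ℝ × ℝ) {x : PlaneL2} (hx : x ∈ testClass) :
    trans z x ∈ testClass := by
  obtain ⟨φ, h, e⟩ := hx
  exact ⟨_, h.translate z, trans_ae_eq e z⟩

theorem IsTest.fderiv {φ : ℝ × ℝ → ℝ} (h : IsTest φ) (e : ℝ × ℝ) :
    IsTest fun w => fderiv ℝ φ w e :=
  ⟨(h.1.fderiv_right (m := ∞) (by simp)).clm_apply contDiff_const, h.2.fderiv_apply (𝕜 := ℝ) e⟩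

theorem hasDerivAt_integral_translate {u ψ : ℝ × ℝ → ℝ} (hu : MemLp u 2) (hψ : IsTest ψ)
    (e : ℝ × ℝ) :
    HasDerivAt (fun t : ℝ => ∫ w, u w * ψ (w + t • e)) (∫ w, u w * fderiv ℝ ψ w e) 0 := by
  -- All `w ↦ fderiv ℝ ψ (w + t • e) e` with `|t| ≤ 1` vanish outside this compact set, on which the
  -- `L²` function `u` is integrable.
  set K : Set (ℝ × ℝ) := (fun z : (ℝ × ℝ) × ℝ => z.1 - z.2 • e) ''
    (tsupport (fun w => fderiv ℝ ψ w e) ×ˢ Icc (-1) 1) with hK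
  have hKc : IsCompact K := ((hψ.fderiv e).2.isCompact.prod isCompact_Icc).image (by fun_prop)
  obtain ⟨C, hC⟩ := (hψ.fderiv e).2.exists_bound_of_continuous (hψ.fderiv e).1.continuous
  have hloc : LocallyIntegrable u := hu.locallyIntegrable (by norm_num)
  have h := hasDerivAt_integral_of_dominated_loc_of_deriv_le (𝕜 := ℝ) (μ := volume) (x₀ := (0 : ℝ))
    (F := fun t w => u w * ψ (w + t • e)) (F' := fun t w => u w * fderiv ℝ ψ (w + t • e) e)
    (s := Metric.ball 0 1) (bound := K.indicator fun w => |u w| * C)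
    (Metric.ball_mem_nhds 0 one_pos) (Eventually.of_forall fun t =>
      hu.1.mul (hψ.translate (t • e)).memLp.1) ?_ ?_ ?_ ?_ ?_
  · simpa using h.2
  · exact hu.integrable_mul (hψ.translate ((0 : ℝ) • e)).memLp
  · exact hu.1.mul ((hψ.fderiv e).translate ((0 : ℝ) • e)).memLp.1
  · refine Eventually.of_forall fun w t ht => ?_
    rw [norm_mul, Real.norm_eq_abs]
    by_cases hw : w ∈ K
    · rw [indicator_of_mem hw]
      exact mul_le_mul_of_nonneg_left (hC _) (abs_nonneg _)
    · rw [indicator_of_notMem hw]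
      have : fderiv ℝ ψ (w + t • e) e = 0 := by
        by_contra hne
        refine hw ⟨(w + t • e, t), ⟨subset_tsupport _ hne, ?_⟩, by simp⟩
        rw [Metric.mem_ball, dist_zero_right, Real.norm_eq_abs] at ht
        exact abs_le.1 ht.le
      rw [this]; simp
  · rw [integrable_indicator_iff hKc.measurableSet]
    exact (hloc.integrableOn_isCompact hKc).abs.mul_const C
  · refine Eventually.of_forall fun w t _ => HasDerivAt.const_mul _ ?_
    have h1 : HasFDerivAt ψ (fderiv ℝ ψ (w + t • e)) (w + t • e) :=
      (hψ.1.differentiable (by simp) _).hasFDerivAt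
    have h2 : HasDerivAt (fun t : ℝ => w + t • e) e t := by
      simpa using ((hasDerivAt_id t).smul_const e).const_add w
    exact h1.comp_hasDerivAt t h2

/-- This converts the distributional derivative into the weak derivative along the translation flow
used in the abstract estimates. -/
theorem hasDerivAt_inner_trans {u g : PlaneL2} {f k : ℝ × ℝ → ℝ} {e : ℝ × ℝ}
    (hu : u =ᵐ[volume] f) (hg : g =ᵐ[volume] k)
    (hw : ∀ φ, IsTest φ → ∫ w, f w * fderiv ℝ φ w e = -∫ w, k w * φ w) :
    ∀ x ∈ testClass,
      HasDerivAt (fun t => inner ℝ u ((transFlow e).map t x)) (-inner ℝ g x) 0 := by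
  rintro x ⟨φ, hφ, hx⟩
  have hf : MemLp f 2 := (memLp_congr_ae hu).1 (Lp.memLp u)
  rw [inner_eq_integral hg hx, ← hw φ hφ]
  refine (hasDerivAt_integral_translate hf hφ e).congr_of_eventuallyEq
    (Eventually.of_forall fun t => ?_)
  exact inner_eq_integral hu (trans_ae_eq hx _)

theorem IsTest.integral_mul_fderiv {φ ψ : ℝ × ℝ → ℝ} (hφ : IsTest φ) (hψ : IsTest ψ)
    (e : ℝ × ℝ) : ∫ w, φ w * _root_.fderiv ℝ ψ w e = -∫ w, _root_.fderiv ℝ φ w e * ψ w :=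
  integral_mul_fderiv_eq_neg_fderiv_mul_of_integrable
    ((hφ.fderiv e).memLp.integrable_mul hψ.memLp) (hφ.memLp.integrable_mul (hψ.fderiv e).memLp)
    (hφ.memLp.integrable_mul hψ.memLp) (fun w _ => hφ.1.differentiable (by simp) w)
    (fun w _ => hψ.1.differentiable (by simp) w)

/-- The classical derivative of a test function is also its weak derivative, so
`norm_diff_le_of_weak` applies. -/
theorem exists_norm_diff_le_of_mem_testClass (e : ℝ × ℝ) {x : PlaneL2} (hx : x ∈ testClass) :
    ∃ L, ∀ h, ‖(transFlow e).diff h x‖ ≤ L * |h| := by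
  obtain ⟨φ, hφ, hx⟩ := hx
  have hg := (hφ.fderiv e).memLp
  refine ⟨‖hg.toLp _‖, fun h => ?_⟩
  rw [mul_comm]
  exact (transFlow e).norm_diff_le_of_weak dense_testClass (fun t y hy => trans_mem_testClass _ hy)
    (hasDerivAt_inner_trans hx hg.coeFn_toLp fun ψ hψ => hφ.integral_mul_fderiv hψ e) h

/-! ### The fractional Laplacian as an integral of translation differences -/

/-- The integrand is at most `2 |h|^{-1-s} min(1, |h|)`, hence integrable, and it is positive on
`(0, 1)`. Positivity allows division by `C_s` in the weak equation. -/
theorem fracConst_pos {s : ℝ} (hs : 0 < s) (hs' : s < 1) : 0 < fracConst s := by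
  have hnn : ∀ h : ℝ, 0 ≤ (1 - Real.cos h) / |h| ^ (1 + s) := fun h =>
    div_nonneg (by linarith [Real.cos_le_one h]) (by positivity)
  refine inv_pos.2 ((integral_pos_iff_support_of_nonneg hnn ?_).2 ?_)
  · refine ((integrable_kernel hs hs').const_mul 2).mono'
      (by fun_prop : Measurable fun h : ℝ => (1 - Real.cos h) / |h| ^ (1 + s)).aestronglyMeasurable
      (Eventually.of_forall fun h => ?_)
    rw [Real.norm_eq_abs, abs_of_nonneg (hnn h), div_eq_mul_inv, ← Real.rpow_neg (abs_nonneg h),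
      mul_comm, mul_left_comm]
    refine mul_le_mul_of_nonneg_left ?_ (by positivity)
    rcases le_total 1 |h| with h1 | h1
    · rw [min_eq_left h1]; linarith [Real.neg_one_le_cos h]
    · rw [min_eq_right h1]
      have := Real.one_sub_sq_div_two_le_cos (x := h)
      nlinarith [sq_abs h, abs_nonneg h]
  · refine lt_of_lt_of_le (b := volume (Ioo (0 : ℝ) 1)) (by simp) (measure_mono fun h hh => ?_)
    have h1 : Real.cos h < 1 := by
      have := Real.cos_lt_cos_of_nonneg_of_le_pi_div_two le_rfl
        (by linarith [Real.pi_gt_three, hh.2]) hh.1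
      rwa [Real.cos_zero] at this
    have h2 : 0 < |h| := abs_pos.2 hh.1.ne'
    exact (div_pos (by linarith) (by positivity)).ne'

theorem fracLapY_eq (s : ℝ) (φ : ℝ × ℝ → ℝ) (w : ℝ × ℝ) :
    fracLapY s φ w
      = fracConst s * ∫ h : ℝ, |h| ^ (-(1 + s)) * (φ w - φ (w + h • ((0 : ℝ), (1 : ℝ)))) := by
  rw [fracLapY, ← integral_add_left_eq_self _ w.2]
  congr 2; ext h
  rw [Real.rpow_neg (abs_nonneg h), div_eq_inv_mul]
  have e : w + h • ((0 : ℝ), (1 : ℝ)) = (w.1, w.2 + h) := by ext <;> simp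
  rw [e]; simp

/-- Fubini puts the weak equation into the abstract form of `norm_sub_avg_le_of_weak`. Absolute
convergence comes from Cauchy–Schwarz in `w` for each `h`, then from the Lipschitz bound on the
translates of `φ`. -/
theorem integral_mul_fracLapY {s : ℝ} (hs : 0 < s) (hs' : s < 1) {u x : PlaneL2}
    {f φ : ℝ × ℝ → ℝ} (hu : u =ᵐ[volume] f) (hφ : IsTest φ) (hx : x =ᵐ[volume] φ) :
    ∫ w, f w * fracLapY s φ w = fracConst s *
      ∫ h : ℝ, |h| ^ (-(1 + s)) * inner ℝ u ((transFlow (0, 1)).diff h x) := by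
  obtain ⟨L, hL⟩ := exists_norm_diff_le_of_mem_testClass (0, 1) (x := x) ⟨φ, hφ, hx⟩
  have hd : ∀ h : ℝ, (transFlow (0, 1)).diff h x =ᵐ[volume]
      fun w => φ w - φ (w + h • ((0 : ℝ), (1 : ℝ))) := fun h => by
    refine (Lp.coeFn_sub _ _).trans ?_
    filter_upwards [hx, trans_ae_eq hx (h • ((0 : ℝ), (1 : ℝ)))] with w h1 h2
    rw [Pi.sub_apply, h1, transFlow_map, h2]
  have hf : MemLp f 2 := (memLp_congr_ae hu).1 (Lp.memLp u)
  have hint : Integrable (Function.uncurry fun (w : ℝ × ℝ) (h : ℝ) =>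
      f w * (|h| ^ (-(1 + s)) * (φ w - φ (w + h • ((0 : ℝ), (1 : ℝ))))))
      (volume.prod volume) := by
    have hc : Continuous φ := hφ.1.continuous
    have hm : AEStronglyMeasurable (Function.uncurry fun (w : ℝ × ℝ) (h : ℝ) =>
        f w * (|h| ^ (-(1 + s)) * (φ w - φ (w + h • ((0 : ℝ), (1 : ℝ))))))
        (volume.prod volume) := by
      refine hf.1.comp_fst.mul (Measurable.aestronglyMeasurable (Measurable.mul ?_ ?_))
      · exact (by fun_prop : Measurable fun h : ℝ => |h| ^ (-(1 + s))).comp measurable_snd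
      · exact Continuous.measurable (by fun_prop)
    rw [integrable_prod_iff']
    · refine ⟨Eventually.of_forall fun h => ?_, ?_⟩
      · have := (integrable_mul_of_ae hu (hd h)).const_mul (|h| ^ (-(1 + s)))
        refine this.congr (Eventually.of_forall fun w => ?_)
        simp only [Function.uncurry_apply_pair]; ring
      · refine (((transFlow (0, 1)).integrable_smul_diff hs hs' hL).norm.const_mul ‖u‖).mono' ?_
          (Eventually.of_forall fun h => ?_)
        · exact hm.norm.prod_swap.integral_prod_right'
        · rw [Real.norm_eq_abs, abs_of_nonneg (integral_nonneg fun _ => norm_nonneg _)]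
          have h0 : 0 ≤ |h| ^ (-(1 + s)) := by positivity
          rw [norm_smul, Real.norm_eq_abs, abs_of_nonneg h0, mul_left_comm]
          refine le_trans (le_of_eq ?_) (mul_le_mul_of_nonneg_left
            (integral_abs_mul_abs_le hu (hd h)) h0)
          rw [← integral_const_mul]
          congr 1; ext w
          rw [Function.uncurry_apply_pair, norm_mul, norm_mul, Real.norm_eq_abs, Real.norm_eq_abs,
            Real.norm_eq_abs, abs_of_nonneg h0]; ring
    · exact hm
  have e1 : ∀ w, f w * fracLapY s φ w = fracConst s * ∫ h : ℝ,
      f w * (|h| ^ (-(1 + s)) * (φ w - φ (w + h • ((0 : ℝ), (1 : ℝ))))) := fun w => by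
    rw [fracLapY_eq, integral_const_mul]; ring
  simp only [e1]
  rw [integral_const_mul, integral_integral_swap hint]
  congr 2; ext h
  rw [inner_eq_integral hu (hd h), ← integral_const_mul]
  congr 1; ext w; ring

/-! ### Box averages -/

/-- Restriction of the `L¹` norm to a set of finite measure, after a translation. -/
theorem setIntegral_abs_translate_le (v : PlaneL2) (z : ℝ × ℝ) {S : Set (ℝ × ℝ)}
    (hS : MeasurableSet S) (hf : volume S ≠ ⊤) :
    IntegrableOn (fun w => |v (w + z)|) S ∧
      ∫ w in S, |v (w + z)| ≤ √(volume.real S) * ‖v‖ := by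
  have hae : ∀ᵐ w, (|trans z v| : PlaneL2) w = |v (w + z)| := by
    filter_upwards [coeFn_trans z v, Lp.coeFn_abs (trans z v)] with w h1 h2
    rw [h2, h1]
  have hi : IntegrableOn (fun w => |trans z v| w) S :=
    integrableOn_Lp_of_measure_ne_top _ fact_one_le_two_ennreal.elim hf
  refine ⟨hi.congr (ae_restrict_of_ae hae), ?_⟩
  rw [← integral_congr_ae (ae_restrict_of_ae hae),
    ← L2.inner_indicatorConstLp_one (𝕜 := ℝ) hS hf]
  refine (real_inner_le_norm _ _).trans (le_of_eq ?_)
  rw [norm_abs_eq_norm, (trans z).norm_map, norm_indicatorConstLp (by simp) (by simp),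
    Real.sqrt_eq_rpow]
  simp

/-- After exchanging integrals, Cauchy–Schwarz over `B` is uniform in `w ∈ S`. The resulting linear
dependence on the measure of `S` is what gives a pointwise bound below. -/
theorem abs_integral_box_le (v : PlaneL2) {B S : Set (ℝ × ℝ)} (hB : MeasurableSet B)
    (hBf : volume B ≠ ⊤) (hS : MeasurableSet S) (hf : volume S ≠ ⊤) :
    |∫ z in B, inner ℝ (trans z v) (indicatorConstLp 2 hS hf (1 : ℝ))|
      ≤ √(volume.real B) * ‖v‖ * volume.real S := by
  have : IsFiniteMeasure (volume.restrict B) := ⟨by simpa using hBf.lt_top⟩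
  have : IsFiniteMeasure (volume.restrict S) := ⟨by simpa using hf.lt_top⟩
  have hin : ∀ z, inner ℝ (trans z v) (indicatorConstLp 2 hS hf (1 : ℝ))
      = ∫ w in S, v (w + z) := fun z => by
    rw [real_inner_comm, L2.inner_indicatorConstLp_one]
    exact integral_congr_ae (ae_restrict_of_ae (coeFn_trans z v))
  have hm : StronglyMeasurable (Function.uncurry fun z w : ℝ × ℝ => |v (w + z)|) :=
    ((Lp.stronglyMeasurable v).comp_measurable
      (measurable_snd.add measurable_fst)).norm
  have hint : Integrable (Function.uncurry fun z w : ℝ × ℝ => |v (w + z)|)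
      ((volume.restrict B).prod (volume.restrict S)) := by
    rw [integrable_prod_iff hm.aestronglyMeasurable]
    refine ⟨Eventually.of_forall fun z => (setIntegral_abs_translate_le v z hS hf).1, ?_⟩
    refine (integrable_const (√(volume.real S) * ‖v‖)).mono'
      hm.aestronglyMeasurable.norm.integral_prod_right' (Eventually.of_forall fun z => ?_)
    rw [Real.norm_eq_abs, abs_of_nonneg (integral_nonneg fun _ => norm_nonneg _)]
    simpa using (setIntegral_abs_translate_le v z hS hf).2
  simp only [hin]
  calc |∫ z in B, ∫ w in S, v (w + z)| ≤ ∫ z in B, |∫ w in S, v (w + z)| :=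
        abs_integral_le_integral_abs
    _ ≤ ∫ z in B, ∫ w in S, |v (w + z)| :=
        integral_mono_of_nonneg (Eventually.of_forall fun _ => abs_nonneg _)
          hint.integral_prod_left (Eventually.of_forall fun _ => abs_integral_le_integral_abs)
    _ = ∫ w in S, ∫ z in B, |v (w + z)| := integral_integral_swap hint
    _ ≤ ∫ w in S, √(volume.real B) * ‖v‖ := by
        refine integral_mono_of_nonneg (Eventually.of_forall fun _ =>
          integral_nonneg fun _ => abs_nonneg _) (integrable_const _)
          (Eventually.of_forall fun w => ?_)
        have := (setIntegral_abs_translate_le v w hB hBf).2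
        simpa only [add_comm w] using this
    _ = _ := by simp [mul_comm]

/-- The average over the box `[-ε, ε] × [-r, r]`. -/
def boxAvg (ε r : ℝ) : PlaneL2 →L[ℝ] PlaneL2 :=
  ((transFlow (1, 0)).avg ε).comp ((transFlow (0, 1)).avg r)

theorem boxAvg_apply (ε r : ℝ) (v : PlaneL2) :
    boxAvg ε r v = (transFlow (1, 0)).avg ε ((transFlow (0, 1)).avg r v) := rfl

theorem norm_boxAvg_le (ε r : ℝ) (v : PlaneL2) : ‖boxAvg ε r v‖ ≤ ‖v‖ :=
  ((transFlow (1, 0)).norm_avg_le _ _).trans ((transFlow (0, 1)).norm_avg_le _ _)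

theorem inner_boxAvg {ε r : ℝ} (hε : 0 < ε) (hr : 0 < r) (v x : PlaneL2) :
    inner ℝ (boxAvg ε r v) x
      = (4 * ε * r)⁻¹ * ∫ z in Ioc (-ε) ε ×ˢ Ioc (-r) r, inner ℝ (trans z v) x := by
  have hc : Continuous fun z => inner ℝ (trans z v) x := (continuous_trans v).inner continuous_const
  have hi : IntegrableOn (fun z => inner ℝ (trans z v) x) (Ioc (-ε) ε ×ˢ Ioc (-r) r)
      (volume.prod volume) :=
    (hc.continuousOn.integrableOn_compact (isCompact_Icc.prod isCompact_Icc)).mono_set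
      (prod_mono Ioc_subset_Icc_self Ioc_subset_Icc_self)
  have hp : ∫ z in Ioc (-ε) ε ×ˢ Ioc (-r) r, inner ℝ (trans z v) x
      = ∫ t in Ioc (-ε) ε, ∫ τ in Ioc (-r) r, inner ℝ (trans (t, τ) v) x := setIntegral_prod _ hi
  rw [hp, boxAvg_apply, IsometryFlow.inner_avg, intervalIntegral.integral_of_le (by linarith)]
  have h1 : ∀ t : ℝ, inner ℝ ((transFlow (1, 0)).map t ((transFlow (0, 1)).avg r v)) x
      = (2 * r)⁻¹ * ∫ τ in Ioc (-r) r, inner ℝ (trans (t, τ) v) x := fun t => by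
    rw [IsometryFlow.inner_map, IsometryFlow.inner_avg,
      intervalIntegral.integral_of_le (by linarith)]
    congr 2; ext τ
    rw [← IsometryFlow.inner_map, transFlow_map, transFlow_map, ← trans_add]
    simp
  simp only [h1]
  rw [integral_const_mul, ← mul_assoc]
  congr 1
  rw [← mul_inv]; congr 1; ring

/-- The integral over any set `S` of finite measure is at most `M |S|` in absolute value, which
forces the bound `M` almost everywhere. -/
theorem ae_abs_boxAvg_le {ε r : ℝ} (hε : 0 < ε) (hr : 0 < r) (v : PlaneL2) :
    ∀ᵐ w, |boxAvg ε r v w| ≤ (√(4 * ε * r))⁻¹ * ‖v‖ := by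
  set M := (√(4 * ε * r))⁻¹ * ‖v‖ with hM
  set B : Set (ℝ × ℝ) := Ioc (-ε) ε ×ˢ Ioc (-r) r with hBdef
  have hBm : MeasurableSet B := measurableSet_Ioc.prod measurableSet_Ioc
  have hBv : volume B = ENNReal.ofReal (4 * ε * r) := by
    rw [hBdef, Measure.volume_eq_prod, Measure.prod_prod, Real.volume_Ioc, Real.volume_Ioc,
      ← ENNReal.ofReal_mul (by linarith)]
    congr 1; ring
  have hBr : volume.real B = 4 * ε * r := by
    rw [measureReal_def, hBv, ENNReal.toReal_ofReal (by positivity)]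
  have hint : ∀ S, MeasurableSet S → volume S < ⊤ → IntegrableOn (boxAvg ε r v) S :=
    fun S hS hf => integrableOn_Lp_of_measure_ne_top _ fact_one_le_two_ennreal.elim hf.ne
  have hset : ∀ S, MeasurableSet S → volume S < ⊤ →
      |∫ w in S, boxAvg ε r v w| ≤ M * volume.real S := fun S hS hf => by
    rw [← L2.inner_indicatorConstLp_one (𝕜 := ℝ) hS hf.ne, real_inner_comm, inner_boxAvg hε hr,
      abs_mul, abs_of_pos (by positivity)]
    have h1 := abs_integral_box_le v hBm (by rw [hBv]; simp) hS hf.ne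
    rw [hBr] at h1
    refine (mul_le_mul_of_nonneg_left h1 (by positivity)).trans (le_of_eq ?_)
    have h2 : (4 * ε * r)⁻¹ * √(4 * ε * r) = (√(4 * ε * r))⁻¹ := by
      have h3 : 0 < 4 * ε * r := by positivity
      rw [inv_mul_eq_div, Real.sqrt_div_self]
    rw [hM, ← h2]; ring
  have hcon : ∀ S, volume S < ⊤ → IntegrableOn (fun _ : ℝ × ℝ => M) S := fun S hf =>
    integrableOn_const hf.ne
  have h1 := ae_nonneg_of_forall_setIntegral_nonneg_of_sigmaFinite (μ := volume)
    (f := fun w => M - boxAvg ε r v w) (fun S hS hf => (hcon S hf).sub (hint S hS hf))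
    fun S hS hf => by
      rw [integral_sub (hcon S hf) (hint S hS hf), setIntegral_const, smul_eq_mul]
      linarith [(abs_le.1 (hset S hS hf)).2]
  have h2 := ae_nonneg_of_forall_setIntegral_nonneg_of_sigmaFinite (μ := volume)
    (f := fun w => M + boxAvg ε r v w) (fun S hS hf => (hcon S hf).add (hint S hS hf))
    fun S hS hf => by
      rw [integral_add (hcon S hf) (hint S hS hf), setIntegral_const, smul_eq_mul]
      linarith [(abs_le.1 (hset S hS hf)).1]
  filter_upwards [h1, h2] with w h3 h4
  simp only [Pi.zero_apply] at h3 h4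
  exact abs_le.2 ⟨by linarith, by linarith⟩

theorem trans_boxAvg (ε r : ℝ) (z : ℝ × ℝ) (v : PlaneL2) :
    trans z (boxAvg ε r v) = boxAvg ε r (trans z v) := by
  have hc : ∀ e r v, trans z ((transFlow e).avg r v) = (transFlow e).avg r (trans z v) :=
    fun e r v => (transFlow e).commute_avg (trans z).toContinuousLinearMap (fun t u => by
      simp only [LinearIsometry.coe_toContinuousLinearMap, transFlow_map, ← trans_add, add_comm]) r v
  rw [boxAvg_apply, hc, hc, boxAvg_apply]

theorem boxAvg_comm (ε r ε' r' : ℝ) (v : PlaneL2) :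
    boxAvg ε r (boxAvg ε' r' v) = boxAvg ε' r' (boxAvg ε r v) := by
  have hc : ∀ e ρ v, boxAvg ε r ((transFlow e).avg ρ v) = (transFlow e).avg ρ (boxAvg ε r v) :=
    fun e ρ v => (transFlow e).commute_avg (boxAvg ε r) (fun t u => (trans_boxAvg _ _ _ _).symm) ρ v
  rw [boxAvg_apply ε' r', hc, hc, boxAvg_apply ε' r']

/-- Approximation by box averages, controlled by weak derivatives. -/
theorem norm_sub_boxAvg_le {s : ℝ} (hs : 0 < s) (hs' : s < 1) {u g k : PlaneL2}
    {f gx gy : ℝ × ℝ → ℝ} (hu : u =ᵐ[volume] f) (hg : g =ᵐ[volume] gx) (hk : k =ᵐ[volume] gy)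
    (hx : IsWeakDx f gx) (hy : IsWeakFracY s f gy) {ε r : ℝ} (hε : 0 < ε) (hr : 0 < r) :
    ‖u - boxAvg ε r u‖ ≤ ε * ‖g‖ + r ^ s * ((fracConst s)⁻¹ * ‖k‖) := by
  have hc := fracConst_pos hs hs'
  have h1 : ‖u - (transFlow (1, 0)).avg ε u‖ ≤ ε * ‖g‖ :=
    (transFlow (1, 0)).norm_sub_avg_le_of_weak_deriv dense_testClass
      (fun t y hy => trans_mem_testClass _ hy) (hasDerivAt_inner_trans hu hg hx) hε
  have h2 : ‖u - (transFlow (0, 1)).avg r u‖ ≤ r ^ s / 2 * ‖(fracConst s)⁻¹ • k‖ := by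
    refine (transFlow (0, 1)).norm_sub_avg_le_of_weak hs hs' dense_testClass
      (fun t y hy => trans_mem_testClass _ hy)
      (fun x hx => exists_norm_diff_le_of_mem_testClass _ hx) ?_ hr
    rintro x ⟨φ, hφ, hxφ⟩
    have h3 := integral_mul_fracLapY hs hs' hu hφ hxφ
    rw [hy φ hφ, ← inner_eq_integral hk hxφ] at h3
    rw [inner_smul_left, h3]
    simp [hc.ne']
  rw [norm_smul, norm_inv, Real.norm_eq_abs, abs_of_pos hc] at h2
  have h3 : ‖(transFlow (1, 0)).avg ε (u - (transFlow (0, 1)).avg r u)‖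
      ≤ r ^ s * ((fracConst s)⁻¹ * ‖k‖) := by
    refine ((transFlow (1, 0)).norm_avg_le _ _).trans (h2.trans ?_)
    refine mul_le_mul_of_nonneg_right ?_ (by positivity)
    have : 0 < r ^ s := by positivity
    linarith
  -- With `A`, `B` the averages in `x` and `y`, this is `1 - AB = (1 - A) + A(1 - B)`, and `A` is a
  -- contraction.
  have e : u - boxAvg ε r u = (u - (transFlow (1, 0)).avg ε u)
      + (transFlow (1, 0)).avg ε (u - (transFlow (0, 1)).avg r u) := by
    rw [boxAvg_apply, map_sub]; abel
  rw [e]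
  exact (norm_add_le _ _).trans (add_le_add h1 h3)

/-! ### The subcritical embedding -/

/-- Interpolation between `L²` and `L^∞`, from `|f|^p ≤ M^{p-2} |f|²`. -/
theorem eLpNorm_le_of_ae_abs_le {f : PlaneL2} {M N p : ℝ} (hM : 0 ≤ M) (hp : 2 ≤ p)
    (hN : ‖f‖ ≤ N) (hf : ∀ᵐ w, |f w| ≤ M) :
    eLpNorm f (ENNReal.ofReal p) volume ≤ ENNReal.ofReal (M ^ (1 - 2 / p) * N ^ (2 / p)) := by
  have hp0 : 0 < p := by linarith
  have hN0 : 0 ≤ N := (norm_nonneg f).trans hN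
  rw [eLpNorm_eq_lintegral_rpow_enorm_toReal (by simpa using hp0) (by simp),
    ENNReal.toReal_ofReal hp0.le]
  have h2 : ∫⁻ w, ‖f w‖ₑ ^ (2 : ℝ) ≤ ENNReal.ofReal N ^ (2 : ℝ) := by
    have h3 : eLpNorm f 2 volume ≤ ENNReal.ofReal N := by
      rw [← ENNReal.ofReal_toReal (Lp.eLpNorm_ne_top f), ← Lp.norm_def]
      exact ENNReal.ofReal_le_ofReal hN
    rw [eLpNorm_eq_lintegral_rpow_enorm_toReal (by simp) (by simp), ENNReal.toReal_ofNat] at h3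
    rwa [one_div, ENNReal.rpow_inv_le_iff (by norm_num)] at h3
  have h1 : ∫⁻ w, ‖f w‖ₑ ^ p ≤ ENNReal.ofReal M ^ (p - 2) * ENNReal.ofReal N ^ (2 : ℝ) := by
    calc ∫⁻ w, ‖f w‖ₑ ^ p ≤ ∫⁻ w, ENNReal.ofReal M ^ (p - 2) * ‖f w‖ₑ ^ (2 : ℝ) := by
          refine lintegral_mono_ae ?_
          filter_upwards [hf] with w hw
          have h4 : ‖f w‖ₑ ≤ ENNReal.ofReal M := by
            rw [← ofReal_norm, Real.norm_eq_abs]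
            exact ENNReal.ofReal_le_ofReal hw
          calc ‖f w‖ₑ ^ p = ‖f w‖ₑ ^ ((p - 2) + 2) := by rw [sub_add_cancel]
            _ = ‖f w‖ₑ ^ (p - 2) * ‖f w‖ₑ ^ (2 : ℝ) :=
                ENNReal.rpow_add_of_nonneg _ _ (by linarith) (by norm_num)
            _ ≤ _ := mul_le_mul_left (ENNReal.rpow_le_rpow h4 (by linarith)) _
      _ = ENNReal.ofReal M ^ (p - 2) * ∫⁻ w, ‖f w‖ₑ ^ (2 : ℝ) :=
          lintegral_const_mul' _ _ (ENNReal.rpow_ne_top_of_nonneg (by linarith) (by simp))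
      _ ≤ _ := mul_le_mul_right h2 _
  refine (ENNReal.rpow_le_rpow h1 (by positivity)).trans (le_of_eq ?_)
  rw [ENNReal.mul_rpow_of_nonneg _ _ (by positivity), ← ENNReal.rpow_mul, ← ENNReal.rpow_mul,
    ENNReal.ofReal_rpow_of_nonneg hM (by have : 0 ≤ p - 2 := by linarith
                                         positivity),
    ENNReal.ofReal_rpow_of_nonneg hN0 (by positivity), ← ENNReal.ofReal_mul (by positivity)]
  congr 3
  · field_simp
  · ring

/-- If `u` is approximated in `L²` by a sequence whose increments decay geometrically in `Lᵖ`,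
then it is in `Lᵖ`. -/
theorem eLpNorm_le_of_increments {u : PlaneL2} {T : ℕ → PlaneL2} {p : ENNReal} (hp : 1 ≤ p)
    {B A ρ : ℝ} (hB : 0 ≤ B) (hA : 0 ≤ A) (hρ : 0 ≤ ρ) (hρ' : ρ < 1)
    (hT : Tendsto T atTop (𝓝 u)) (h0 : eLpNorm (T 0) p volume ≤ ENNReal.ofReal B)
    (hinc : ∀ k, eLpNorm (T (k + 1) - T k : PlaneL2) p volume ≤ ENNReal.ofReal (A * ρ ^ k)) :
    eLpNorm u p volume ≤ ENNReal.ofReal (B + A / (1 - ρ)) := by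
  have hsum : ∀ n, eLpNorm (T n) p volume
      ≤ ENNReal.ofReal (B + A * ∑ k ∈ Finset.range n, ρ ^ k) := by
    intro n
    induction n with
    | zero => simpa using h0
    | succ n ih =>
      have e : (T (n + 1) : ℝ × ℝ → ℝ) =ᵐ[volume] T n + (T (n + 1) - T n : PlaneL2) := by
        filter_upwards [Lp.coeFn_sub (T (n + 1)) (T n)] with w hw
        rw [Pi.add_apply, hw, Pi.sub_apply]; ring
      rw [eLpNorm_congr_ae e]
      refine (eLpNorm_add_le (Lp.aestronglyMeasurable _) (Lp.aestronglyMeasurable _) hp).trans ?_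
      refine (add_le_add ih (hinc n)).trans (le_of_eq ?_)
      rw [← ENNReal.ofReal_add (by positivity) (by positivity), Finset.sum_range_succ]
      congr 1; ring
  have hbd : ∀ n, eLpNorm (T n) p volume ≤ ENNReal.ofReal (B + A / (1 - ρ)) := fun n => by
    refine (hsum n).trans (ENNReal.ofReal_le_ofReal ?_)
    rw [div_eq_mul_inv]
    have := (summable_geometric_of_lt_one hρ hρ').sum_le_tsum (Finset.range n)
      (fun _ _ => by positivity)
    rw [tsum_geometric_of_lt_one hρ hρ'] at this
    gcongr
  -- A subsequence converges almost everywhere, and Fatou passes the uniform bound to the limit.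
  obtain ⟨σ, -, hσ⟩ :=
    (tendstoInMeasure_of_tendsto_Lp hT).exists_seq_tendsto_ae
  refine (Lp.eLpNorm_lim_le_liminf_eLpNorm (fun n => Lp.aestronglyMeasurable (T (σ n))) u hσ).trans
    ?_
  exact liminf_le_of_le (by isBoundedDefault) fun b hb => by
    obtain ⟨n, hn⟩ := hb.exists
    exact hn.trans (hbd _)

/-- The square of the norm of `H^{1,s}`. -/
def sobolevSq (s : ℝ) (u : ℝ × ℝ → ℝ) : ℝ := (∫ w, u w ^ 2) + kinetic s u

theorem kinetic_eq {s : ℝ} {u gx gy : ℝ × ℝ → ℝ} (hgx : MemLp gx 2) (hgy : MemLp gy 2)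
    (hx : IsWeakDx u gx) (hy : IsWeakFracY s u gy) :
    kinetic s u = (∫ w, gx w ^ 2) + ∫ w, gy w ^ 2 := by
  rw [kinetic, ← integral_add hgx.integrable_sq hgy.integrable_sq]
  refine integral_congr_ae ?_
  filter_upwards [weakDx_ae_eq hgx hx, weakFracY_ae_eq hgy hy] with w h1 h2
  rw [h1, h2, sq_abs, sq_abs]

theorem inv_sqrt_box_le {s ε : ℝ} (hs : 0 < s) (hε : 0 < ε) :
    (√(4 * ε * ε ^ (1 / s)))⁻¹ ≤ ε ^ (-((1 + 1 / s) / 2)) := by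
  rw [Real.rpow_neg hε.le]
  refine inv_anti₀ (by positivity) ?_
  rw [Real.sqrt_eq_rpow]
  have e : ε ^ ((1 + 1 / s) / 2) = (ε * ε ^ (1 / s)) ^ ((1 : ℝ) / 2) := by
    rw [← Real.rpow_one_add' hε.le (by positivity), ← Real.rpow_mul hε.le]; congr 1; ring
  rw [e]
  refine Real.rpow_le_rpow (by positivity) ?_ (by norm_num)
  have : 0 < ε * ε ^ (1 / s) := by positivity
  linarith

/-- The approximants are `S_k² u`, with `S_k` the box average at scale `2^{-k}`. Since the averages
commute, `S_{k+1}² u - S_k² u = (S_{k+1} + S_k) d` with `d = S_{k+1} u - S_k u`. The inner factor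
`d` is small in `L²`, and the outer average turns this into an `L^∞` bound. -/
theorem exists_eLpNorm_le {s p : ℝ} (hs : 0 < s) (hs' : s < 1) (hp : 2 < p)
    (hp' : p < 2 * (1 + s) / (1 - s)) :
    ∃ C : ℝ, 0 < C ∧ ∀ f : ℝ × ℝ → ℝ, MemH s f →
      eLpNorm f (ENNReal.ofReal p) volume ≤ ENNReal.ofReal (C * √(sobolevSq s f)) := by
  set c : ℝ := 1 + (fracConst s)⁻¹ with hc
  have hc0 : 0 < (fracConst s)⁻¹ := inv_pos.2 (fracConst_pos hs hs')
  have hcpos : 0 < c := by positivity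
  set κ : ℝ := (1 + 1 / s) / 2 with hκ
  have hκpos : 0 < κ := by positivity
  -- The decay exponent `(1 - κ)(1 - 2/p) + 2/p` from interpolation, positive exactly when `p <
  -- 2_s`.
  set θ : ℝ := 1 - κ * (1 - 2 / p) with hθ
  have hθpos : 0 < θ := by
    rw [lt_div_iff₀ (by linarith)] at hp'
    have : θ = (2 * (1 + s) - p * (1 - s)) / (2 * s * p) := by
      rw [hθ, hκ]; field_simp; ring
    rw [this]
    exact div_pos (by linarith) (by positivity)
  set ρ : ℝ := (1 / 2) ^ θ with hρ
  have hρ0 : 0 ≤ ρ := by positivity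
  have hρ1 : ρ < 1 := Real.rpow_lt_one (by norm_num) (by norm_num) hθpos
  -- Large enough for both the `L²` bound and the `L^∞` bound on the increments.
  set A : ℝ := 4 * c * (1 + 2 ^ κ) with hA
  have hApos : 0 < A := by positivity
  refine ⟨1 + A / (1 - ρ), by have : 0 < 1 - ρ := by linarith
                              positivity, ?_⟩
  rintro f ⟨hf, ⟨gx, hgx, hx⟩, ⟨gy, hgy, hy⟩⟩
  set E : ℝ := √(sobolevSq s f) with hE
  have hE0 : 0 ≤ E := Real.sqrt_nonneg _
  set u : PlaneL2 := hf.toLp f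
  have hu : u =ᵐ[volume] f := hf.coeFn_toLp
  have hsq : sobolevSq s f = ‖u‖ ^ 2 + (‖hgx.toLp gx‖ ^ 2 + ‖hgy.toLp gy‖ ^ 2) := by
    rw [sobolevSq, kinetic_eq hgx hgy hx hy, norm_sq_eq_integral hu,
      norm_sq_eq_integral hgx.coeFn_toLp, norm_sq_eq_integral hgy.coeFn_toLp]
  have hn1 : ‖u‖ ≤ E := Real.le_sqrt_of_sq_le (by
    rw [hsq]; nlinarith [sq_nonneg ‖hgx.toLp gx‖, sq_nonneg ‖hgy.toLp gy‖])
  have hn2 : ‖hgx.toLp gx‖ ≤ E := Real.le_sqrt_of_sq_le (by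
    rw [hsq]; nlinarith [sq_nonneg ‖u‖, sq_nonneg ‖hgy.toLp gy‖])
  have hn3 : ‖hgy.toLp gy‖ ≤ E := Real.le_sqrt_of_sq_le (by
    rw [hsq]; nlinarith [sq_nonneg ‖u‖, sq_nonneg ‖hgx.toLp gx‖])
  set ε : ℕ → ℝ := fun k => (1 / 2) ^ k with hε
  have hεpos : ∀ k, 0 < ε k := fun k => by simp only [hε]; positivity
  have hεsucc : ∀ k, ε (k + 1) = ε k / 2 := fun k => by simp only [hε]; rw [pow_succ]; ring
  set S : ℕ → PlaneL2 →L[ℝ] PlaneL2 := fun k => boxAvg (ε k) (ε k ^ (1 / s)) with hS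
  have hSn : ∀ k v, ‖S k v‖ ≤ ‖v‖ := fun k v => norm_boxAvg_le _ _ v
  have hSc : ∀ j k v, S j (S k v) = S k (S j v) := fun j k v => boxAvg_comm _ _ _ _ v
  have hSa : ∀ k, ‖u - S k u‖ ≤ c * E * ε k := fun k => by
    have h := norm_sub_boxAvg_le hs hs' hu hgx.coeFn_toLp hgy.coeFn_toLp hx hy (hεpos k)
      (r := ε k ^ (1 / s)) (by have := hεpos k; positivity)
    rw [← Real.rpow_mul (hεpos k).le, one_div_mul_cancel hs.ne', Real.rpow_one] at h
    refine h.trans ?_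
    rw [hc]
    have h1 := mul_le_mul_of_nonneg_left hn2 (hεpos k).le
    have h2 := mul_le_mul_of_nonneg_left (mul_le_mul_of_nonneg_left hn3 hc0.le) (hεpos k).le
    linarith
  have hSinf : ∀ k v, ∀ᵐ w, |S k v w| ≤ ε k ^ (-κ) * ‖v‖ := fun k v => by
    filter_upwards [ae_abs_boxAvg_le (hεpos k) (r := ε k ^ (1 / s))
      (by have := hεpos k; positivity) v] with w hw
    exact hw.trans (mul_le_mul_of_nonneg_right (inv_sqrt_box_le hs (hεpos k)) (norm_nonneg _))
  have key := eLpNorm_le_of_increments (u := u) (T := fun k => S k (S k u))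
    (p := ENNReal.ofReal p) (by rw [ENNReal.one_le_ofReal]; linarith) (B := E) (A := A * E)
    hE0 (by positivity) hρ0 hρ1 ?_ ?_ ?_
  · rw [← eLpNorm_congr_ae hu]
    refine key.trans (ENNReal.ofReal_le_ofReal (le_of_eq ?_))
    ring
  · rw [tendsto_iff_norm_sub_tendsto_zero]
    have hlim : Tendsto (fun k => 2 * (c * E) * ε k) atTop (𝓝 0) := by
      have := (tendsto_pow_atTop_nhds_zero_of_lt_one (r := (1 / 2 : ℝ)) (by norm_num)
        (by norm_num)).const_mul (2 * (c * E))
      rwa [mul_zero] at this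
    refine squeeze_zero (fun _ => norm_nonneg _) (fun k => ?_) hlim
    have e : S k (S k u) - u = -((u - S k u) + S k (u - S k u)) := by rw [map_sub]; abel
    rw [e, norm_neg]
    have h1 := norm_add_le (u - S k u) (S k (u - S k u))
    have h2 := hSn k (u - S k u)
    linarith [hSa k]
  · have hn : ‖S 0 (S 0 u)‖ ≤ E := (hSn _ _).trans ((hSn _ _).trans hn1)
    have hb : ∀ᵐ w, |S 0 (S 0 u) w| ≤ E := by
      filter_upwards [hSinf 0 (S 0 u)] with w hw
      refine hw.trans ?_
      simp only [hε, pow_zero, Real.one_rpow, one_mul]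
      exact (hSn _ _).trans hn1
    refine (eLpNorm_le_of_ae_abs_le hE0 hp.le hn hb).trans (ENNReal.ofReal_le_ofReal ?_)
    rw [← Real.rpow_add' hE0 (by simp)]; simp
  · intro k
    set d : PlaneL2 := S (k + 1) u - S k u with hd
    have hdn : ‖d‖ ≤ 2 * (c * E) * ε k := by
      have e : d = (u - S k u) - (u - S (k + 1) u) := by rw [hd]; abel
      rw [e]
      have h1 := norm_sub_le (u - S k u) (u - S (k + 1) u)
      have h2 := hSa (k + 1)
      rw [hεsucc] at h2
      have : 0 ≤ c * E * ε k := by have := hεpos k; positivity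
      linarith [hSa k]
    have hT : S (k + 1) (S (k + 1) u) - S k (S k u) = S (k + 1) d + S k d := by
      rw [hd, map_sub, map_sub, hSc k (k + 1)]; abel
    have hp2 : (2 : ℝ) ^ κ ≥ 0 := by positivity
    have hεκ : ε (k + 1) ^ (-κ) = 2 ^ κ * ε k ^ (-κ) := by
      rw [hεsucc, Real.div_rpow (hεpos k).le (by norm_num), Real.rpow_neg (by norm_num : (0:ℝ) ≤ 2)]
      field_simp
    have hN : ‖S (k + 1) d + S k d‖ ≤ A * E * ε k := by
      have h1 := norm_add_le (S (k + 1) d) (S k d)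
      have h2 := hSn (k + 1) d
      have h3 := hSn k d
      have h4 : 0 ≤ 4 * c * 2 ^ κ * (E * ε k) := by have := hεpos k; positivity
      rw [hA]; nlinarith
    have hM : ∀ᵐ w, |(S (k + 1) d + S k d : PlaneL2) w| ≤ A * E * ε k ^ (1 - κ) := by
      filter_upwards [Lp.coeFn_add (S (k + 1) d) (S k d), hSinf (k + 1) d, hSinf k d]
        with w h1 h2 h3
      rw [h1, Pi.add_apply]
      refine (abs_add_le _ _).trans ((add_le_add h2 h3).trans ?_)
      rw [hεκ]
      have h4 : ε k ^ (1 - κ) = ε k * ε k ^ (-κ) := by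
        rw [sub_eq_add_neg, Real.rpow_add (hεpos k), Real.rpow_one]
      have h5 : 0 < ε k ^ (-κ) := by have := hεpos k; positivity
      calc 2 ^ κ * ε k ^ (-κ) * ‖d‖ + ε k ^ (-κ) * ‖d‖
          = (1 + 2 ^ κ) * ε k ^ (-κ) * ‖d‖ := by ring
        _ ≤ (1 + 2 ^ κ) * ε k ^ (-κ) * (2 * (c * E) * ε k) :=
            mul_le_mul_of_nonneg_left hdn (by positivity)
        _ ≤ A * E * ε k ^ (1 - κ) := by
            rw [h4, hA]
            have : 0 ≤ (1 + 2 ^ κ) * ε k ^ (-κ) * (2 * (c * E) * ε k) := by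
              have := hεpos k; positivity
            linarith
    change eLpNorm (S (k + 1) (S (k + 1) u) - S k (S k u) : PlaneL2) _ _ ≤ _
    rw [hT]
    have hek := hεpos k
    refine (eLpNorm_le_of_ae_abs_le (by positivity) hp.le hN hM).trans
      (ENNReal.ofReal_le_ofReal (le_of_eq ?_))
    rw [Real.mul_rpow (by positivity) (by positivity), Real.mul_rpow (by positivity) hek.le]
    calc (A * E) ^ (1 - 2 / p) * (ε k ^ (1 - κ)) ^ (1 - 2 / p) * ((A * E) ^ (2 / p) * ε k ^ (2 / p))
        = ((A * E) ^ (1 - 2 / p) * (A * E) ^ (2 / p)) *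
          ((ε k ^ (1 - κ)) ^ (1 - 2 / p) * ε k ^ (2 / p)) := by ring
      _ = A * E * ε k ^ θ := by
          rw [← Real.rpow_add' (by positivity) (by simp), ← Real.rpow_mul hek.le,
            ← Real.rpow_add hek]
          congr 2
          · simp
          · rw [hθ]; ring
      _ = A * E * ρ ^ k := by
          rw [hρ, ← Real.rpow_natCast, ← Real.rpow_mul (by norm_num), mul_comm θ,
            Real.rpow_mul (by norm_num), Real.rpow_natCast]

/-- The subcritical embedding `H^{1,s}(ℝ²) ⊂ Lᵖ(ℝ²)`. -/
theorem exists_integral_rpow_le {s p : ℝ} (hs : 0 < s) (hs' : s < 1) (hp : 2 < p)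
    (hp' : p < 2 * (1 + s) / (1 - s)) :
    ∃ C : ℝ, 0 < C ∧ ∀ f : ℝ × ℝ → ℝ, MemH s f →
      Integrable (fun w => |f w| ^ p) ∧ ∫ w, |f w| ^ p ≤ C * sobolevSq s f ^ (p / 2) := by
  obtain ⟨C, hC, h⟩ := exists_eLpNorm_le hs hs' hp hp'
  have hp0 : 0 < p := by linarith
  refine ⟨C ^ p, by positivity, fun f hf => ?_⟩
  have hle := h f hf
  have hm : MemLp f (ENNReal.ofReal p) := ⟨hf.1.1, hle.trans_lt ENNReal.ofReal_lt_top⟩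
  have hi := hm.integrable_norm_rpow (by simpa using hp0) (by simp)
  rw [ENNReal.toReal_ofReal hp0.le] at hi
  refine ⟨hi, ?_⟩
  rw [hm.eLpNorm_eq_integral_rpow_norm (by simpa using hp0) (by simp),
    ENNReal.toReal_ofReal hp0.le, ENNReal.ofReal_le_ofReal_iff (by positivity)] at hle
  have hi0 : 0 ≤ ∫ w, ‖f w‖ ^ p := integral_nonneg fun _ => by positivity
  rw [Real.rpow_inv_le_iff_of_pos hi0 (by positivity) hp0,
    Real.mul_rpow hC.le (Real.sqrt_nonneg _)] at hle
  refine hle.trans (le_of_eq ?_)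
  rw [Real.sqrt_eq_rpow, ← Real.rpow_mul]
  · congr 2; ring
  · refine add_nonneg (integral_nonneg fun _ => sq_nonneg _) (integral_nonneg fun _ => by positivity)

/-! ### Anisotropic scaling and the fiber map -/

/-- Diagonal scaling of the plane. -/
def scale (a b : ℝ) (z : ℝ × ℝ) : ℝ × ℝ := (a * z.1, b * z.2)

theorem map_scale {a b : ℝ} (ha : 0 < a) (hb : 0 < b) :
    Measure.map (scale a b) volume = ENNReal.ofReal (a⁻¹ * b⁻¹) • volume := by
  have h := Measure.map_prod_map (volume : Measure ℝ) (volume : Measure ℝ)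
    (measurable_const_mul a) (measurable_const_mul b)
  rw [Real.map_volume_mul_left ha.ne', Real.map_volume_mul_left hb.ne'] at h
  rw [Measure.volume_eq_prod, show scale a b = Prod.map (a * ·) (b * ·) from rfl, ← h,
    Measure.prod_smul_left, Measure.prod_smul_right, smul_smul, abs_of_pos (inv_pos.2 ha),
    abs_of_pos (inv_pos.2 hb), ← ENNReal.ofReal_mul (by positivity)]

theorem measurableEmbedding_scale {a b : ℝ} (ha : 0 < a) (hb : 0 < b) :
    MeasurableEmbedding (scale a b) :=
  ((measurableEmbedding_mulLeft₀ ha.ne').prodMap (measurableEmbedding_mulLeft₀ hb.ne'))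

theorem integral_scale {a b : ℝ} (ha : 0 < a) (hb : 0 < b) (f : ℝ × ℝ → ℝ) :
    ∫ z, f (scale a b z) = a⁻¹ * b⁻¹ * ∫ z, f z := by
  rw [← (measurableEmbedding_scale ha hb).integral_map, map_scale ha hb, integral_smul_measure,
    ENNReal.toReal_ofReal (by positivity), smul_eq_mul]

theorem memLp_scale {a b : ℝ} (ha : 0 < a) (hb : 0 < b) {f : ℝ × ℝ → ℝ} (hf : MemLp f 2) :
    MemLp (fun z => f (scale a b z)) 2 := by
  have : MemLp f 2 (Measure.map (scale a b) volume) := by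
    rw [map_scale ha hb]; exact hf.smul_measure (by simp)
  exact (measurableEmbedding_scale ha hb).memLp_map_measure_iff.1 this

theorem ae_eq_zero_of_scale {a b : ℝ} (ha : 0 < a) (hb : 0 < b) {f : ℝ × ℝ → ℝ}
    (h : (fun z => f (scale a b z)) =ᵐ[volume] 0) : f =ᵐ[volume] 0 := by
  have h1 : f =ᵐ[Measure.map (scale a b) volume] 0 :=
    (measurableEmbedding_scale ha hb).ae_map_iff.2 h
  rw [map_scale ha hb] at h1
  have h0 : ENNReal.ofReal (a⁻¹ * b⁻¹) ≠ 0 := (ENNReal.ofReal_pos.2 (by positivity)).ne'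
  exact (Measure.ae_ennreal_smul_measure_iff h0).1 h1

theorem scale_inv_scale {a b : ℝ} (ha : 0 < a) (hb : 0 < b) (z : ℝ × ℝ) :
    scale a⁻¹ b⁻¹ (scale a b z) = z := by
  simp [scale, inv_mul_cancel_left₀ ha.ne', inv_mul_cancel_left₀ hb.ne']

/-- Diagonal scaling as a continuous linear map. -/
def scaleCLM (a b : ℝ) : ℝ × ℝ →L[ℝ] ℝ × ℝ :=
  (a • ContinuousLinearMap.id ℝ ℝ).prodMap (b • ContinuousLinearMap.id ℝ ℝ)

theorem scaleCLM_apply (a b : ℝ) (z : ℝ × ℝ) : scaleCLM a b z = scale a b z := rfl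

theorem IsTest.scale {φ : ℝ × ℝ → ℝ} (h : IsTest φ) {a b : ℝ} (ha : 0 < a) (hb : 0 < b) :
    IsTest fun z => φ (scale a b z) := by
  refine ⟨h.1.comp (scaleCLM a b).contDiff, ?_⟩
  have : IsCompact (MixedSchrodinger.scale a⁻¹ b⁻¹ '' tsupport φ) :=
    h.2.isCompact.image (scaleCLM a⁻¹ b⁻¹).continuous
  refine HasCompactSupport.intro this fun z hz => ?_
  by_contra hne
  exact hz ⟨_, subset_tsupport φ hne, scale_inv_scale ha hb z⟩

/-- Testing a scaled function amounts to testing the function with a scaled test function. -/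
theorem integral_scale_mul {a b : ℝ} (ha : 0 < a) (hb : 0 < b) (f k : ℝ × ℝ → ℝ) :
    ∫ z, f (scale a b z) * k z = a⁻¹ * b⁻¹ * ∫ z, f z * k (scale a⁻¹ b⁻¹ z) := by
  rw [← integral_scale ha hb]
  simp only [scale_inv_scale ha hb]

theorem fderiv_scale {φ : ℝ × ℝ → ℝ} (h : IsTest φ) (a b : ℝ) (z : ℝ × ℝ) :
    fderiv ℝ (fun z => φ (scale a b z)) z (1, 0) = a * fderiv ℝ φ (scale a b z) (1, 0) := by
  have h1 : HasFDerivAt φ (fderiv ℝ φ (scaleCLM a b z)) (scaleCLM a b z) :=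
    (h.1.differentiable (by simp) _).hasFDerivAt
  have h2 := h1.comp z (scaleCLM a b).hasFDerivAt
  have e : scaleCLM a b (1, 0) = a • ((1 : ℝ), (0 : ℝ)) := by simp [scaleCLM_apply, scale]
  change fderiv ℝ (φ ∘ scaleCLM a b) z (1, 0) = _
  rw [h2.fderiv, ContinuousLinearMap.comp_apply, e, map_smul, smul_eq_mul]
  rfl

/-- Homogeneity of order `s`: the kernel contributes `b^{1+s}` and the change of variables `b⁻¹`. -/
theorem fracLapY_scale {s : ℝ} (φ : ℝ × ℝ → ℝ) (a : ℝ) {b : ℝ} (hb : 0 < b) (z : ℝ × ℝ) :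
    fracLapY s (fun z => φ (scale a b z)) z = b ^ s * fracLapY s φ (scale a b z) := by
  rw [fracLapY, fracLapY, mul_left_comm]
  congr 1
  have h := Measure.integral_comp_mul_left
    (fun y => (φ (scale a b z) - φ ((scale a b z).1, y)) / |(scale a b z).2 - y| ^ (1 + s)) b
  rw [abs_of_pos (inv_pos.2 hb), smul_eq_mul, eq_inv_mul_iff_mul_eq₀ hb.ne'] at h
  rw [← h, ← integral_const_mul, ← integral_const_mul]
  congr 1; ext y
  simp only [scale]
  rw [← mul_sub, abs_mul, abs_of_pos hb, Real.mul_rpow hb.le (abs_nonneg _), Real.rpow_add hb,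
    Real.rpow_one]
  field_simp

theorem IsWeakDx.scale {u g : ℝ × ℝ → ℝ} (h : IsWeakDx u g) (m : ℝ) {a b : ℝ} (ha : 0 < a)
    (hb : 0 < b) : IsWeakDx (fun z => m * u (scale a b z)) fun z => m * a * g (scale a b z) := by
  intro φ hφ
  have hφ' := hφ.scale (inv_pos.2 ha) (inv_pos.2 hb)
  have h1 := h _ hφ'
  simp only [fderiv_scale hφ] at h1
  simp only [mul_assoc]
  rw [integral_const_mul, integral_const_mul, integral_const_mul, integral_scale_mul ha hb,
    integral_scale_mul ha hb]
  have h2 : ∫ z, u z * (a⁻¹ * fderiv ℝ φ (MixedSchrodinger.scale a⁻¹ b⁻¹ z) (1, 0))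
      = a⁻¹ * ∫ z, u z * fderiv ℝ φ (MixedSchrodinger.scale a⁻¹ b⁻¹ z) (1, 0) := by
    rw [← integral_const_mul]; congr 1; ext z; ring
  rw [h2, inv_mul_eq_iff_eq_mul₀ ha.ne'] at h1
  rw [h1]; ring

theorem IsWeakFracY.scale {s : ℝ} {u g : ℝ × ℝ → ℝ} (h : IsWeakFracY s u g) (m : ℝ) {a b : ℝ}
    (ha : 0 < a) (hb : 0 < b) :
    IsWeakFracY s (fun z => m * u (scale a b z)) fun z => m * b ^ s * g (scale a b z) := by
  intro φ hφ
  have hφ' := hφ.scale (inv_pos.2 ha) (inv_pos.2 hb)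
  have h1 := h _ hφ'
  simp only [fracLapY_scale φ a⁻¹ (inv_pos.2 hb)] at h1
  simp only [mul_assoc]
  rw [integral_const_mul, integral_const_mul, integral_const_mul, integral_scale_mul ha hb,
    integral_scale_mul ha hb]
  have h2 : ∫ z, u z * (b⁻¹ ^ s * fracLapY s φ (MixedSchrodinger.scale a⁻¹ b⁻¹ z))
      = b⁻¹ ^ s * ∫ z, u z * fracLapY s φ (MixedSchrodinger.scale a⁻¹ b⁻¹ z) := by
    rw [← integral_const_mul]; congr 1; ext z; ring
  have hbs : 0 < b ^ s := by positivity
  rw [h2, Real.inv_rpow hb.le, inv_mul_eq_iff_eq_mul₀ hbs.ne'] at h1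
  rw [h1]; ring

theorem dilate_eq (s t : ℝ) (u : ℝ × ℝ → ℝ) :
    dilate s t u = fun z => t ^ ((1 + s) / 2) * u (scale (t ^ s) t z) := rfl

theorem MemH.const_mul_scale {s : ℝ} {u : ℝ × ℝ → ℝ} (h : MemH s u) (m : ℝ) {a b : ℝ}
    (ha : 0 < a) (hb : 0 < b) : MemH s fun z => m * u (scale a b z) := by
  obtain ⟨hu, ⟨gx, hgx, hx⟩, ⟨gy, hgy, hy⟩⟩ := h
  exact ⟨(memLp_scale ha hb hu).const_mul m,
    ⟨_, (memLp_scale ha hb hgx).const_mul _, hx.scale m ha hb⟩,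
    ⟨_, (memLp_scale ha hb hgy).const_mul _, hy.scale m ha hb⟩⟩

theorem MemH.dilate {s t : ℝ} (ht : 0 < t) {u : ℝ × ℝ → ℝ} (h : MemH s u) :
    MemH s (dilate s t u) :=
  h.const_mul_scale _ (Real.rpow_pos_of_pos ht s) ht

theorem sq_rpow_half {s t : ℝ} (ht : 0 < t) : (t ^ ((1 + s) / 2)) ^ 2 = t * t ^ s := by
  rw [← Real.rpow_natCast, ← Real.rpow_mul ht.le, Nat.cast_ofNat, div_mul_cancel₀ _ two_ne_zero,
    Real.rpow_add ht, Real.rpow_one]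

/-- Stretching `x` by `t^s` and `y` by `t` gives both weak derivatives the same factor `t^s`. The
prefactor squared cancels the Jacobian. -/
theorem kinetic_dilate {s t : ℝ} (ht : 0 < t) {u : ℝ × ℝ → ℝ} (h : MemH s u) :
    kinetic s (dilate s t u) = t ^ (2 * s) * kinetic s u := by
  obtain ⟨hu, ⟨gx, hgx, hx⟩, ⟨gy, hgy, hy⟩⟩ := h
  have hts : 0 < t ^ s := Real.rpow_pos_of_pos ht s
  rw [dilate_eq, kinetic_eq ((memLp_scale hts ht hgx).const_mul _)
    ((memLp_scale hts ht hgy).const_mul _) (hx.scale _ hts ht) (hy.scale _ hts ht),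
    kinetic_eq hgx hgy hx hy]
  simp only [mul_pow]
  rw [integral_const_mul, integral_const_mul, integral_scale hts ht fun z => gx z ^ 2,
    integral_scale hts ht fun z => gy z ^ 2]
  have e2 : t ^ (2 * s) = (t ^ s) ^ 2 := by
    rw [← Real.rpow_natCast, ← Real.rpow_mul ht.le]; congr 1; push_cast; ring
  rw [sq_rpow_half ht, e2]; field_simp

theorem integral_sq_dilate {s t : ℝ} (ht : 0 < t) (u : ℝ × ℝ → ℝ) :
    ∫ z, dilate s t u z ^ 2 = ∫ z, u z ^ 2 := by
  have hts : 0 < t ^ s := Real.rpow_pos_of_pos ht s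
  simp only [dilate_eq, mul_pow]
  rw [integral_const_mul, integral_scale hts ht fun z => u z ^ 2]
  rw [sq_rpow_half ht]; field_simp

theorem integral_dilate_mul {s t : ℝ} (ht : 0 < t) (u v : ℝ × ℝ → ℝ) (p q : ℝ) :
    ∫ z, |dilate s t u z| ^ p * |dilate s t v z| ^ q
      = t ^ ((1 + s) * (p + q - 2) / 2) * ∫ z, |u z| ^ p * |v z| ^ q := by
  have hts : 0 < t ^ s := Real.rpow_pos_of_pos ht s
  have hm : 0 < t ^ ((1 + s) / 2) := Real.rpow_pos_of_pos ht _
  have e : ∀ z, |dilate s t u z| ^ p * |dilate s t v z| ^ q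
      = (t ^ ((1 + s) / 2)) ^ (p + q) *
        (|u (scale (t ^ s) t z)| ^ p * |v (scale (t ^ s) t z)| ^ q) := fun z => by
    simp only [dilate_eq, abs_mul, abs_of_pos hm]
    rw [Real.mul_rpow hm.le (abs_nonneg _), Real.mul_rpow hm.le (abs_nonneg _),
      Real.rpow_add hm]; ring
  simp only [e]
  rw [integral_const_mul, integral_scale hts ht fun z => |u z| ^ p * |v z| ^ q, ← mul_assoc]
  congr 1
  rw [← Real.rpow_mul ht.le, ← Real.rpow_neg ht.le, ← Real.rpow_neg_one t, ← Real.rpow_add ht,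
    ← Real.rpow_add ht]
  congr 1; ring

theorem integral_dilate {s t : ℝ} (ht : 0 < t) (u : ℝ × ℝ → ℝ) (p : ℝ) :
    ∫ z, |dilate s t u z| ^ p = t ^ ((1 + s) * (p - 2) / 2) * ∫ z, |u z| ^ p := by
  have := integral_dilate_mul (s := s) ht u u p 0
  simpa using this

theorem dilate_dilate {s t τ : ℝ} (ht : 0 < t) (hτ : 0 < τ) (u : ℝ × ℝ → ℝ) :
    dilate s τ (dilate s t u) = dilate s (τ * t) u := by
  ext z
  simp only [dilate]
  rw [Real.mul_rpow hτ.le ht.le, Real.mul_rpow hτ.le ht.le]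
  have e1 : t ^ s * (τ ^ s * z.1) = τ ^ s * t ^ s * z.1 := by ring
  have e2 : t * (τ * z.2) = τ * t * z.2 := by ring
  rw [e1, e2]; ring

theorem ae_eq_zero_of_dilate {s t : ℝ} (ht : 0 < t) {u : ℝ × ℝ → ℝ}
    (h : dilate s t u =ᵐ[volume] 0) : u =ᵐ[volume] 0 := by
  refine ae_eq_zero_of_scale (Real.rpow_pos_of_pos ht s) ht ?_
  filter_upwards [h] with z hz
  have hm : 0 < t ^ ((1 + s) / 2) := Real.rpow_pos_of_pos ht _
  exact (mul_eq_zero.1 hz).resolve_left hm.ne'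

theorem dilate_mem_nonzeroPairs {s a b t : ℝ} (ht : 0 < t) {w : Pair}
    (hw : w ∈ nonzeroPairs s a b) :
    ((dilate s t w.1, dilate s t w.2) : Pair) ∈ nonzeroPairs s a b := by
  obtain ⟨⟨⟨h1, h2⟩, h3, h4⟩, h5⟩ := hw
  exact ⟨⟨⟨h1.dilate ht, (integral_sq_dilate ht _).le.trans h2⟩,
    h3.dilate ht, (integral_sq_dilate ht _).le.trans h4⟩,
    fun h => h5 ⟨ae_eq_zero_of_dilate ht h.1, ae_eq_zero_of_dilate ht h.2⟩⟩

/-- The weak fractional Laplacian is the Bochner integral of the differences in `L²`. The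
substitution `h ↦ -h` supplies its symmetry. -/
theorem IsTest.memH {s : ℝ} (hs : 0 < s) (hs' : s < 1) {φ : ℝ × ℝ → ℝ} (h : IsTest φ) :
    MemH s φ := by
  refine ⟨h.memLp, ⟨_, (h.fderiv (1, 0)).memLp, fun ψ hψ => h.integral_mul_fderiv hψ (1, 0)⟩, ?_⟩
  set x : PlaneL2 := h.memLp.toLp φ
  have hx : x =ᵐ[volume] φ := h.memLp.coeFn_toLp
  obtain ⟨L, hL⟩ := exists_norm_diff_le_of_mem_testClass (0, 1) (x := x) ⟨φ, h, hx⟩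
  have hi := (transFlow (0, 1)).integrable_smul_diff hs hs' hL
  set g : PlaneL2 := fracConst s • ∫ h, |h| ^ (-(1 + s)) • (transFlow (0, 1)).diff h x with hg
  refine ⟨g, Lp.memLp g, fun ψ hψ => ?_⟩
  have hy := hψ.memLp.coeFn_toLp
  set y : PlaneL2 := hψ.memLp.toLp ψ
  rw [integral_mul_fracLapY hs hs' hx hψ hy,
    ← inner_eq_integral (Eventually.of_forall fun _ => rfl) hy, hg, inner_smul_left,
    real_inner_comm, ← integral_inner hi]
  simp only [conj_trivial]
  congr 1
  rw [← integral_neg_eq_self]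
  congr 1; ext h
  rw [abs_neg, inner_smul_right, ← IsometryFlow.inner_diff, real_inner_comm]

theorem memH_zero (s : ℝ) : MemH s 0 :=
  ⟨MemLp.zero, ⟨0, MemLp.zero, fun φ _ => by simp⟩, ⟨0, MemLp.zero, fun φ _ => by simp⟩⟩

theorem nonzeroPairs_nonempty {s a b : ℝ} (hs : 0 < s) (hs' : s < 1) (ha : 0 < a) (hb : 0 < b) :
    (nonzeroPairs s a b).Nonempty := by
  let χ : ContDiffBump (0 : ℝ × ℝ) := ⟨1, 2, one_pos, one_lt_two⟩
  have hχ : IsTest χ := ⟨χ.contDiff, χ.hasCompactSupport⟩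
  set I := ∫ z, χ z ^ 2 with hI
  have hI0 : 0 ≤ I := integral_nonneg fun _ => sq_nonneg _
  -- Then `m² I = a I / (I + 1) ≤ a`. The `+ 1` avoids division by zero without a proof that `I >
  -- 0`.
  set m := √(a / (I + 1)) with hm
  have hmpos : 0 < m := Real.sqrt_pos.2 (by positivity)
  refine ⟨(fun z => m * χ z, 0), ⟨⟨⟨?_, ?_⟩, memH_zero s, ?_⟩, ?_⟩⟩
  · have := (hχ.memH hs hs').const_mul_scale m one_pos one_pos
    simpa [scale] using this
  · simp only [mul_pow]
    rw [integral_const_mul, ← hI, hm, Real.sq_sqrt (by positivity), div_mul_eq_mul_div,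
      div_le_iff₀ (by positivity)]
    nlinarith
  · simpa using hb.le
  · rintro ⟨h, -⟩
    have h0 : (fun z => m * χ z) = 0 :=
      (Continuous.ae_eq_iff_eq volume (continuous_const.mul χ.continuous) continuous_const).1 h
    have h1 := congrFun h0 0
    have h2 : χ 0 = 1 := χ.one_of_mem_closedBall (by simp [χ.rIn_pos.le])
    simp [h2, hmpos.ne'] at h1

/-! ### Gagliardo–Nirenberg and positivity of the kinetic energy -/

theorem kinetic_nonneg (s : ℝ) (u : ℝ × ℝ → ℝ) : 0 ≤ kinetic s u :=
  integral_nonneg fun _ => by positivity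

/-- The exponent `(1+s)(p-2)/2` with which `∫ |u|^p` scales under the fiber map. -/
def fiberExp (s p : ℝ) : ℝ := (1 + s) * (p - 2) / 2

theorem two_mul_lt_fiberExp {s p : ℝ} (hs : 0 < s) (hp : 2 * (1 + 3 * s) / (1 + s) < p) :
    2 * s < fiberExp s p := by
  rw [div_lt_iff₀ (by linarith)] at hp
  rw [fiberExp]; linarith

theorem two_lt_of_mass_supercritical {s p : ℝ} (hs : 0 < s)
    (hp : 2 * (1 + 3 * s) / (1 + s) < p) : 2 < p := by
  refine lt_trans ?_ hp
  rw [lt_div_iff₀ (by linarith)]; linarith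

/-- Gagliardo–Nirenberg inequality on `D_a`. -/
theorem exists_integral_rpow_le_kinetic {s p : ℝ} (hs : 0 < s) (hs' : s < 1) (hp : 2 < p)
    (hp' : p < 2 * (1 + s) / (1 - s)) {a : ℝ} (ha : 0 < a) :
    ∃ C : ℝ, 0 < C ∧ ∀ u ∈ massBall s a, Integrable (fun w => |u w| ^ p) ∧
      ∀ κ > 0, kinetic s u ≤ κ → ∫ w, |u w| ^ p ≤ C * κ ^ (fiberExp s p / (2 * s)) := by
  obtain ⟨C, hC, h⟩ := exists_integral_rpow_le hs hs' hp hp'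
  refine ⟨C * (a + 1) ^ (p / 2), by positivity, fun u hu => ⟨(h u hu.1).1, fun κ hκ hk => ?_⟩⟩
  -- This dilation makes the kinetic energy at most `1`, so the squared norm is at most `a + 1`.
  -- Using an upper bound `κ > 0` keeps the case of zero kinetic energy available.
  set t : ℝ := κ ^ (-(1 / (2 * s))) with ht
  have htpos : 0 < t := by positivity
  have h1 := (h _ (hu.1.dilate htpos)).2
  have ht2 : t ^ (2 * s) = κ⁻¹ := by
    rw [ht, ← Real.rpow_mul hκ.le, ← Real.rpow_neg_one κ]; congr 1; field_simp
  have hte : t ^ fiberExp s p = (κ ^ (fiberExp s p / (2 * s)))⁻¹ := by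
    rw [ht, ← Real.rpow_mul hκ.le, ← Real.rpow_neg hκ.le]; congr 1; ring
  rw [integral_dilate htpos, sobolevSq, integral_sq_dilate htpos, kinetic_dilate htpos hu.1, ht2]
    at h1
  change t ^ fiberExp s p * _ ≤ _ at h1
  rw [hte, inv_mul_le_iff₀ (by positivity), mul_comm] at h1
  refine h1.trans (mul_le_mul_of_nonneg_right (mul_le_mul_of_nonneg_left ?_ hC.le)
    (by positivity))
  have h2 : κ⁻¹ * kinetic s u ≤ 1 := by rw [inv_mul_le_iff₀ hκ]; linarith
  have h3 : 0 ≤ κ⁻¹ * kinetic s u := mul_nonneg (by positivity) (kinetic_nonneg _ _)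
  have h4 : 0 ≤ ∫ z, u z ^ 2 := integral_nonneg fun _ => sq_nonneg _
  exact Real.rpow_le_rpow (by linarith) (by linarith [hu.2]) (by linarith)

theorem ae_eq_zero_of_integral_rpow {u : ℝ × ℝ → ℝ} {p : ℝ} (hp : 0 < p)
    (hi : Integrable fun w => |u w| ^ p) (h : ∫ w, |u w| ^ p ≤ 0) : u =ᵐ[volume] 0 := by
  have h0 := (integral_eq_zero_iff_of_nonneg (fun w => by positivity) hi).1
    (le_antisymm h (integral_nonneg fun w => by positivity))
  filter_upwards [h0] with w hw
  exact abs_eq_zero.1 ((Real.rpow_eq_zero (abs_nonneg _) hp.ne').1 hw)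

/-- If the kinetic energy vanished, Gagliardo–Nirenberg would hold for every `κ > 0`. Letting `κ →
0` gives `∫ |u|^p = 0` for a subcritical `p`. -/
theorem kinetic_pos {s a : ℝ} (hs : 0 < s) (hs' : s < 1) (ha : 0 < a) {u : ℝ × ℝ → ℝ}
    (hu : u ∈ massBall s a) (h0 : ¬ u =ᵐ[volume] 0) : 0 < kinetic s u := by
  have hlt : (2 : ℝ) < 2 * (1 + s) / (1 - s) := by
    rw [lt_div_iff₀ (by linarith)]; linarith
  obtain ⟨p, hp, hp'⟩ := exists_between hlt
  obtain ⟨C, hC, h⟩ := exists_integral_rpow_le_kinetic hs hs' hp hp' ha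
  by_contra! hk
  refine h0 (ae_eq_zero_of_integral_rpow (by linarith) (h u hu).1 ?_)
  have hx : 0 < fiberExp s p / (2 * s) :=
    div_pos (div_pos (mul_pos (by linarith) (by linarith)) two_pos) (by linarith)
  have ht : Tendsto (fun κ : ℝ => C * κ ^ (fiberExp s p / (2 * s))) (𝓝[>] 0) (𝓝 0) := by
    have := ((Real.continuousAt_rpow_const 0 _ (Or.inr hx.le)).tendsto.const_mul C)
    rw [Real.zero_rpow hx.ne', mul_zero] at this
    exact this.mono_left nhdsWithin_le_nhds
  exact ge_of_tendsto ht (eventually_mem_nhdsWithin.mono fun κ hκ =>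
    (h u hu).2 κ hκ (hk.trans (le_of_lt hκ)))

theorem rpow_mul_rpow_le_add {x y r₁ r₂ : ℝ} (hx : 0 ≤ x) (hy : 0 ≤ y) (h₁ : 0 < r₁)
    (h₂ : 0 < r₂) : x ^ r₁ * y ^ r₂ ≤ x ^ (r₁ + r₂) + y ^ (r₁ + r₂) := by
  rcases le_total x y with h | h
  · calc x ^ r₁ * y ^ r₂ ≤ y ^ r₁ * y ^ r₂ := by gcongr
      _ = y ^ (r₁ + r₂) := (Real.rpow_add' hy (by positivity)).symm
      _ ≤ _ := le_add_of_nonneg_left (by positivity)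
  · calc x ^ r₁ * y ^ r₂ ≤ x ^ r₁ * x ^ r₂ := by gcongr
      _ = x ^ (r₁ + r₂) := (Real.rpow_add' hx (by positivity)).symm
      _ ≤ _ := le_add_of_nonneg_right (by positivity)

theorem integral_mul_rpow_le {u v : ℝ × ℝ → ℝ} {r₁ r₂ : ℝ} (h₁ : 0 < r₁) (h₂ : 0 < r₂)
    (hu : Integrable fun w => |u w| ^ (r₁ + r₂)) (hv : Integrable fun w => |v w| ^ (r₁ + r₂)) :
    ∫ w, |u w| ^ r₁ * |v w| ^ r₂ ≤ (∫ w, |u w| ^ (r₁ + r₂)) + ∫ w, |v w| ^ (r₁ + r₂) := by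
  rw [← integral_add hu hv]
  exact integral_mono_of_nonneg (Eventually.of_forall fun w => by positivity) (hu.add hv)
    (Eventually.of_forall fun w => rpow_mul_rpow_le_add (abs_nonneg _) (abs_nonneg _) h₁ h₂)

/-! ### One-variable analysis of the fiber function -/

/-- The fiber function is maximal at `1` as soon as its derivative vanishes there. -/
theorem fiber_le_of_critical {s K A₁ A₂ A₃ e₁ e₂ e₃ : ℝ} (hs : 0 < s) (hA₁ : 0 ≤ A₁)
    (hA₂ : 0 ≤ A₂) (hA₃ : 0 ≤ A₃) (he₁ : 2 * s < e₁) (he₂ : 2 * s < e₂) (he₃ : 2 * s < e₃)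
    (h : s * K = e₁ * A₁ + e₂ * A₂ + e₃ * A₃) {t : ℝ} (ht : 0 < t) :
    1 / 2 * (t ^ (2 * s) * K) - t ^ e₁ * A₁ - t ^ e₂ * A₂ - t ^ e₃ * A₃
      ≤ 1 / 2 * K - A₁ - A₂ - A₃ := by
  -- Bernoulli's inequality for `x = t^{2s}`: the convex power `x^{e/(2s)}` lies above its tangent
  -- at `1`. Weighted by the `A_i` and summed, the tangents cancel the linear kinetic term by `h`.
  have hb : ∀ e, 2 * s < e → e * (t ^ (2 * s) - 1) ≤ 2 * s * (t ^ e - 1) := fun e he => by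
    have hx : 0 < t ^ (2 * s) := by positivity
    have h1 := one_add_mul_self_le_rpow_one_add (s := t ^ (2 * s) - 1) (by linarith)
      (p := e / (2 * s)) (by rw [one_le_div (by linarith)]; linarith)
    rw [add_sub_cancel, ← Real.rpow_mul ht.le, mul_div_cancel₀ _ (by positivity)] at h1
    have h2 : e / (2 * s) * (t ^ (2 * s) - 1) ≤ t ^ e - 1 := by linarith
    rw [div_mul_eq_mul_div, div_le_iff₀ (by positivity)] at h2
    linarith
  have h1 := mul_le_mul_of_nonneg_right (hb e₁ he₁) hA₁
  have h2 := mul_le_mul_of_nonneg_right (hb e₂ he₂) hA₂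
  have h3 := mul_le_mul_of_nonneg_right (hb e₃ he₃) hA₃
  have h4 : s * K * (t ^ (2 * s) - 1)
      = (e₁ * A₁ + e₂ * A₂ + e₃ * A₃) * (t ^ (2 * s) - 1) := by rw [h]
  have h5 : 0 ≤ s * ((1 / 2 * K - A₁ - A₂ - A₃) -
      (1 / 2 * (t ^ (2 * s) * K) - t ^ e₁ * A₁ - t ^ e₂ * A₂ - t ^ e₃ * A₃)) := by linarith
  linarith [nonneg_of_mul_nonneg_right h5 hs]

theorem exists_rpow_mul_ge {k A e : ℝ} (hk : 0 < k) (hA : 0 < A) (he : 0 < e) :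
    ∃ T > 0, k ≤ T ^ e * A := by
  refine ⟨(k / A) ^ (1 / e), by positivity, ?_⟩
  rw [← Real.rpow_mul (by positivity), one_div_mul_cancel he.ne', Real.rpow_one,
    div_mul_cancel₀ _ hA.ne']

/-- After division by `t^{2s}` the equation reads `sK = G(t)`, with `G` continuous, zero at `0` and
eventually at least `sK`. The intermediate value theorem solves it. -/
theorem exists_fiber_critical {s K A₁ A₂ A₃ e₁ e₂ e₃ : ℝ} (hs : 0 < s) (hK : 0 < K)
    (hA₁ : 0 ≤ A₁) (hA₂ : 0 ≤ A₂) (hA₃ : 0 ≤ A₃) (hA : 0 < A₁ ∨ 0 < A₂)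
    (he₁ : 2 * s < e₁) (he₂ : 2 * s < e₂) (he₃ : 2 * s < e₃) :
    ∃ t > 0, s * (t ^ (2 * s) * K)
      = e₁ * (t ^ e₁ * A₁) + e₂ * (t ^ e₂ * A₂) + e₃ * (t ^ e₃ * A₃) := by
  set G : ℝ → ℝ := fun t => t ^ (e₁ - 2 * s) * (e₁ * A₁) + t ^ (e₂ - 2 * s) * (e₂ * A₂)
    + t ^ (e₃ - 2 * s) * (e₃ * A₃) with hG
  have hm₁ : 0 ≤ e₁ * A₁ := mul_nonneg (by linarith) hA₁
  have hm₂ : 0 ≤ e₂ * A₂ := mul_nonneg (by linarith) hA₂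
  have hm₃ : 0 ≤ e₃ * A₃ := mul_nonneg (by linarith) hA₃
  have hsK : 0 < s * K := by positivity
  obtain ⟨T, hT, hGT⟩ : ∃ T > 0, s * K ≤ G T := by
    rcases hA with h | h
    · obtain ⟨T, hT, h1⟩ := exists_rpow_mul_ge hsK (mul_pos (by linarith : 0 < e₁) h)
        (by linarith : 0 < e₁ - 2 * s)
      refine ⟨T, hT, ?_⟩
      have h2 : 0 ≤ T ^ (e₂ - 2 * s) * (e₂ * A₂) := by positivity
      have h3 : 0 ≤ T ^ (e₃ - 2 * s) * (e₃ * A₃) := by positivity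
      simp only [hG]; linarith
    · obtain ⟨T, hT, h1⟩ := exists_rpow_mul_ge hsK (mul_pos (by linarith : 0 < e₂) h)
        (by linarith : 0 < e₂ - 2 * s)
      refine ⟨T, hT, ?_⟩
      have h2 : 0 ≤ T ^ (e₁ - 2 * s) * (e₁ * A₁) := by positivity
      have h3 : 0 ≤ T ^ (e₃ - 2 * s) * (e₃ * A₃) := by positivity
      simp only [hG]; linarith
  have hcont : Continuous G := by
    have hc : ∀ e, 2 * s < e → Continuous fun t : ℝ => t ^ (e - 2 * s) := fun e he =>
      Real.continuous_rpow_const (by linarith)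
    exact (((hc _ he₁).mul_const _).add ((hc _ he₂).mul_const _)).add ((hc _ he₃).mul_const _)
  have hG0 : G 0 = 0 := by
    simp only [hG]
    rw [Real.zero_rpow (by linarith), Real.zero_rpow (by linarith), Real.zero_rpow (by linarith)]
    ring
  obtain ⟨t, ht, hGt⟩ := intermediate_value_Icc hT.le hcont.continuousOn
    (show s * K ∈ Icc (G 0) (G T) from ⟨by rw [hG0]; exact hsK.le, hGT⟩)
  have htpos : 0 < t := by
    refine lt_of_le_of_ne ht.1 fun h => ?_
    rw [← h, hG0] at hGt; linarith
  refine ⟨t, htpos, ?_⟩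
  have hsp : ∀ e, t ^ e = t ^ (2 * s) * t ^ (e - 2 * s) := fun e => by
    rw [← Real.rpow_add htpos]; congr 1; ring
  rw [hsp e₁, hsp e₂, hsp e₃]
  have : s * (t ^ (2 * s) * K) = t ^ (2 * s) * G t := by rw [hGt]; ring
  rw [this]; simp only [hG]; ring

/-! ### Fibers and the Pohozaev set -/

/-- The standing assumptions on the parameters. -/
structure Admissible (c : Coeffs) : Prop where
  s_pos : 0 < c.s
  s_lt : c.s < 1
  μ₁_pos : 0 < c.μ₁
  μ₂_pos : 0 < c.μ₂
  β_pos : 0 < c.β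
  r₁_pos : 0 < c.r₁
  r₂_pos : 0 < c.r₂
  lt_p : 2 * (1 + 3 * c.s) / (1 + c.s) < c.p
  p_lt : c.p < 2 * (1 + c.s) / (1 - c.s)
  lt_q : 2 * (1 + 3 * c.s) / (1 + c.s) < c.q
  q_lt : c.q < 2 * (1 + c.s) / (1 - c.s)
  lt_r : 2 * (1 + 3 * c.s) / (1 + c.s) < c.r₁ + c.r₂
  r_lt : c.r₁ + c.r₂ < 2 * (1 + c.s) / (1 - c.s)

theorem Admissible.two_lt_p {c : Coeffs} (hc : Admissible c) : 2 < c.p :=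
  two_lt_of_mass_supercritical hc.s_pos hc.lt_p

theorem Admissible.two_lt_q {c : Coeffs} (hc : Admissible c) : 2 < c.q :=
  two_lt_of_mass_supercritical hc.s_pos hc.lt_q

/-- The total kinetic energy of a pair. -/
def pairKinetic (c : Coeffs) (w : Pair) : ℝ := kinetic c.s w.1 + kinetic c.s w.2

/-- The self-interaction energy of the first component. -/
def selfEnergy₁ (c : Coeffs) (w : Pair) : ℝ := c.μ₁ / c.p * ∫ z, |w.1 z| ^ c.p

/-- The self-interaction energy of the second component. -/
def selfEnergy₂ (c : Coeffs) (w : Pair) : ℝ := c.μ₂ / c.q * ∫ z, |w.2 z| ^ c.q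

/-- The interaction energy of the two components. -/
def mixedEnergy (c : Coeffs) (w : Pair) : ℝ := c.β * ∫ z, |w.1 z| ^ c.r₁ * |w.2 z| ^ c.r₂

theorem energy_eq (c : Coeffs) (w : Pair) :
    energy c w = 1 / 2 * pairKinetic c w - selfEnergy₁ c w - selfEnergy₂ c w - mixedEnergy c w := by
  simp only [energy, pairKinetic, selfEnergy₁, selfEnergy₂, mixedEnergy]; ring

/-- In this form `P` is visibly the derivative of the fiber energy at `t = 1`: each interaction
energy is multiplied by its scaling exponent. -/
theorem pohozaev_eq (c : Coeffs) (w : Pair) :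
    pohozaev c w = c.s * pairKinetic c w - fiberExp c.s c.p * selfEnergy₁ c w
      - fiberExp c.s c.q * selfEnergy₂ c w - fiberExp c.s (c.r₁ + c.r₂) * mixedEnergy c w := by
  simp only [pohozaev, pairKinetic, selfEnergy₁, selfEnergy₂, mixedEnergy, fiberExp]; ring

/-- The pair `(u_t, v_t)`. -/
def pairDilate (s t : ℝ) (w : Pair) : Pair := (dilate s t w.1, dilate s t w.2)

theorem fiberEnergy_eq_energy (c : Coeffs) (w : Pair) (t : ℝ) :
    fiberEnergy c w t = energy c (pairDilate c.s t w) := rfl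

theorem pairKinetic_dilate {c : Coeffs} {a b t : ℝ} (ht : 0 < t) {w : Pair}
    (hw : w ∈ nonzeroPairs c.s a b) :
    pairKinetic c (pairDilate c.s t w) = t ^ (2 * c.s) * pairKinetic c w := by
  simp only [pairKinetic, pairDilate]
  rw [kinetic_dilate ht hw.1.1.1, kinetic_dilate ht hw.1.2.1, mul_add]

theorem selfEnergy₁_dilate (c : Coeffs) {t : ℝ} (ht : 0 < t) (w : Pair) :
    selfEnergy₁ c (pairDilate c.s t w) = t ^ fiberExp c.s c.p * selfEnergy₁ c w := by
  simp only [selfEnergy₁, pairDilate]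
  rw [integral_dilate ht, fiberExp]; ring

theorem selfEnergy₂_dilate (c : Coeffs) {t : ℝ} (ht : 0 < t) (w : Pair) :
    selfEnergy₂ c (pairDilate c.s t w) = t ^ fiberExp c.s c.q * selfEnergy₂ c w := by
  simp only [selfEnergy₂, pairDilate]
  rw [integral_dilate ht, fiberExp]; ring

theorem mixedEnergy_dilate (c : Coeffs) {t : ℝ} (ht : 0 < t) (w : Pair) :
    mixedEnergy c (pairDilate c.s t w) = t ^ fiberExp c.s (c.r₁ + c.r₂) * mixedEnergy c w := by
  simp only [mixedEnergy, pairDilate]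
  rw [integral_dilate_mul ht, fiberExp]; ring

namespace Admissible

variable {c : Coeffs} {a b : ℝ} {w : Pair}

theorem selfEnergy₁_nonneg (hc : Admissible c) (w : Pair) : 0 ≤ selfEnergy₁ c w :=
  mul_nonneg (div_nonneg hc.μ₁_pos.le (by linarith [hc.two_lt_p]))
    (integral_nonneg fun _ => by positivity)

theorem selfEnergy₂_nonneg (hc : Admissible c) (w : Pair) : 0 ≤ selfEnergy₂ c w :=
  mul_nonneg (div_nonneg hc.μ₂_pos.le (by linarith [hc.two_lt_q]))
    (integral_nonneg fun _ => by positivity)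

theorem mixedEnergy_nonneg (hc : Admissible c) (w : Pair) : 0 ≤ mixedEnergy c w :=
  mul_nonneg hc.β_pos.le (integral_nonneg fun _ => by positivity)

theorem pairKinetic_pos (hc : Admissible c) (ha : 0 < a) (hb : 0 < b)
    (hw : w ∈ nonzeroPairs c.s a b) : 0 < pairKinetic c w := by
  rcases not_and_or.1 hw.2 with h | h
  · exact add_pos_of_pos_of_nonneg (kinetic_pos hc.s_pos hc.s_lt ha hw.1.1 h) (kinetic_nonneg _ _)
  · exact add_pos_of_nonneg_of_pos (kinetic_nonneg _ _) (kinetic_pos hc.s_pos hc.s_lt hb hw.1.2 h)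

theorem selfEnergy_pos (hc : Admissible c) (ha : 0 < a) (hb : 0 < b)
    (hw : w ∈ nonzeroPairs c.s a b) : 0 < selfEnergy₁ c w ∨ 0 < selfEnergy₂ c w := by
  have hp := hc.two_lt_p
  have hq := hc.two_lt_q
  have hμ₁ := hc.μ₁_pos
  have hμ₂ := hc.μ₂_pos
  rcases not_and_or.1 hw.2 with h | h
  · obtain ⟨C, -, hC⟩ := exists_integral_rpow_le_kinetic hc.s_pos hc.s_lt hp hc.p_lt ha
    refine Or.inl (mul_pos (by positivity) ?_)
    by_contra! h0
    exact h (ae_eq_zero_of_integral_rpow (by linarith) (hC _ hw.1.1).1 h0)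
  · obtain ⟨C, -, hC⟩ := exists_integral_rpow_le_kinetic hc.s_pos hc.s_lt hq hc.q_lt hb
    refine Or.inr (mul_pos (by positivity) ?_)
    by_contra! h0
    exact h (ae_eq_zero_of_integral_rpow (by linarith) (hC _ hw.1.2).1 h0)

/-- On the Pohozaev set the fiber energy is maximal at `t = 1`. -/
theorem fiberEnergy_le (hc : Admissible c) (hw : w ∈ pohozaevSet c a b) {t : ℝ} (ht : 0 < t) :
    fiberEnergy c w t ≤ energy c w := by
  have h := hw.2
  rw [pohozaev_eq] at h
  rw [fiberEnergy_eq_energy, energy_eq, energy_eq, pairKinetic_dilate ht hw.1,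
    selfEnergy₁_dilate c ht, selfEnergy₂_dilate c ht, mixedEnergy_dilate c ht]
  exact fiber_le_of_critical hc.s_pos (hc.selfEnergy₁_nonneg w) (hc.selfEnergy₂_nonneg w)
    (hc.mixedEnergy_nonneg w) (two_mul_lt_fiberExp hc.s_pos hc.lt_p)
    (two_mul_lt_fiberExp hc.s_pos hc.lt_q) (two_mul_lt_fiberExp hc.s_pos hc.lt_r)
    (by linarith) ht

/-- Every fiber meets the Pohozaev set, at a point where the fiber energy is maximal. -/
theorem exists_isGreatest (hc : Admissible c) (ha : 0 < a) (hb : 0 < b)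
    (hw : w ∈ nonzeroPairs c.s a b) :
    ∃ t > 0, pairDilate c.s t w ∈ pohozaevSet c a b ∧
      IsGreatest (fiberEnergy c w '' Ioi 0) (energy c (pairDilate c.s t w)) := by
  obtain ⟨t, ht, h⟩ := exists_fiber_critical hc.s_pos (hc.pairKinetic_pos ha hb hw)
    (hc.selfEnergy₁_nonneg w) (hc.selfEnergy₂_nonneg w) (hc.mixedEnergy_nonneg w)
    (hc.selfEnergy_pos ha hb hw) (two_mul_lt_fiberExp hc.s_pos hc.lt_p)
    (two_mul_lt_fiberExp hc.s_pos hc.lt_q) (two_mul_lt_fiberExp hc.s_pos hc.lt_r)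
  have hmem : pairDilate c.s t w ∈ pohozaevSet c a b := by
    refine ⟨dilate_mem_nonzeroPairs ht hw, ?_⟩
    rw [pohozaev_eq, pairKinetic_dilate ht hw, selfEnergy₁_dilate c ht, selfEnergy₂_dilate c ht,
      mixedEnergy_dilate c ht]
    linarith
  refine ⟨t, ht, hmem, ⟨t, ht, rfl⟩, ?_⟩
  rintro _ ⟨τ, hτ, rfl⟩
  have hτ' : 0 < τ := hτ
  -- The fiber through the dilated pair is the same fiber, so the point `τ` is reached from `t` by
  -- the dilation `τ / t`.
  have h1 := hc.fiberEnergy_le hmem (div_pos hτ' ht)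
  rw [fiberEnergy_eq_energy] at h1 ⊢
  have e : pairDilate c.s (τ / t) (pairDilate c.s t w) = pairDilate c.s τ w := by
    simp only [pairDilate]
    rw [dilate_dilate ht (div_pos hτ' ht), dilate_dilate ht (div_pos hτ' ht),
      div_mul_cancel₀ _ ht.ne']
  rwa [e] at h1

theorem fiberMax_of_mem (hc : Admissible c) (hw : w ∈ pohozaevSet c a b) :
    fiberMax c w = energy c w := by
  refine IsGreatest.csSup_eq ⟨⟨1, mem_Ioi.2 zero_lt_one, ?_⟩, ?_⟩
  · rw [fiberEnergy_eq_energy]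
    congr 1
    ext z <;> simp [pairDilate, dilate]
  · rintro _ ⟨t, ht, rfl⟩
    exact hc.fiberEnergy_le hw ht

theorem image_fiberMax_eq (hc : Admissible c) (ha : 0 < a) (hb : 0 < b) :
    fiberMax c '' nonzeroPairs c.s a b = energy c '' pohozaevSet c a b := by
  ext y
  constructor
  · rintro ⟨w, hw, rfl⟩
    obtain ⟨t, ht, hmem, hmax⟩ := hc.exists_isGreatest ha hb hw
    exact ⟨_, hmem, hmax.csSup_eq.symm⟩
  · rintro ⟨w, hw, rfl⟩
    exact ⟨w, hw.1, hc.fiberMax_of_mem hw⟩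

/-- The kinetic energy is bounded away from `0` on the Pohozaev set. -/
theorem exists_le_pairKinetic (hc : Admissible c) (ha : 0 < a) (hb : 0 < b) :
    ∃ δ > 0, ∀ w ∈ pohozaevSet c a b, δ ≤ pairKinetic c w := by
  have hs := hc.s_pos
  have hμ₁ := hc.μ₁_pos
  have hμ₂ := hc.μ₂_pos
  have hβ := hc.β_pos
  have hp := hc.two_lt_p
  have hq := hc.two_lt_q
  have he₁ := two_mul_lt_fiberExp hs hc.lt_p
  have he₂ := two_mul_lt_fiberExp hs hc.lt_q
  have he₃ := two_mul_lt_fiberExp hs hc.lt_r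
  have hr2 := two_lt_of_mass_supercritical hs hc.lt_r
  obtain ⟨C₁, hC₁, h₁⟩ := exists_integral_rpow_le_kinetic hs hc.s_lt hp hc.p_lt ha
  obtain ⟨C₂, hC₂, h₂⟩ := exists_integral_rpow_le_kinetic hs hc.s_lt hq hc.q_lt hb
  obtain ⟨C₃, hC₃, h₃⟩ := exists_integral_rpow_le_kinetic hs hc.s_lt hr2 hc.r_lt ha
  obtain ⟨C₄, hC₄, h₄⟩ := exists_integral_rpow_le_kinetic hs hc.s_lt hr2 hc.r_lt hb
  set e₁ := fiberExp c.s c.p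
  set e₂ := fiberExp c.s c.q
  set e₃ := fiberExp c.s (c.r₁ + c.r₂)
  set D₁ := e₁ * (c.μ₁ / c.p * C₁)
  set D₂ := e₂ * (c.μ₂ / c.q * C₂)
  set D₃ := e₃ * (c.β * (C₃ + C₄))
  -- With total kinetic energy `κ`, `P = 0` and Gagliardo–Nirenberg give `s κ ≤ G(κ) κ`. All
  -- exponents in `G` are positive, so `G < s` near `0`, which excludes small `κ`. The sum `C₃ + C₄`
  -- comes from bounding the mixed integrand by the two pure powers.
  set G : ℝ → ℝ := fun κ => D₁ * κ ^ (e₁ / (2 * c.s) - 1) + D₂ * κ ^ (e₂ / (2 * c.s) - 1)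
    + D₃ * κ ^ (e₃ / (2 * c.s) - 1) with hG
  have hx : ∀ e, 2 * c.s < e → 0 < e / (2 * c.s) - 1 := fun e he => by
    rw [sub_pos, one_lt_div (by linarith)]; exact he
  have hcont : Continuous G := by
    have hcx : ∀ e, 2 * c.s < e → Continuous fun κ : ℝ => κ ^ (e / (2 * c.s) - 1) := fun e he =>
      Real.continuous_rpow_const (hx e he).le
    exact (((hcx _ he₁).const_mul _).add ((hcx _ he₂).const_mul _)).add ((hcx _ he₃).const_mul _)
  have hG0 : G 0 = 0 := by
    simp only [hG]
    rw [Real.zero_rpow (hx _ he₁).ne', Real.zero_rpow (hx _ he₂).ne',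
      Real.zero_rpow (hx _ he₃).ne']
    ring
  have hev : ∀ᶠ κ in 𝓝 (0 : ℝ), G κ < c.s :=
    hcont.continuousAt.eventually_lt continuousAt_const (by rw [hG0]; exact hs)
  obtain ⟨δ, hδ, hball⟩ := Metric.eventually_nhds_iff.1 hev
  refine ⟨δ, hδ, fun w hw => ?_⟩
  by_contra! hlt
  set κ := pairKinetic c w with hκ
  have hκpos : 0 < κ := hc.pairKinetic_pos ha hb hw.1
  have hGκ : G κ < c.s := hball (by rwa [dist_zero_right, Real.norm_eq_abs, abs_of_pos hκpos])
  have hk₁ : kinetic c.s w.1 ≤ κ := le_add_of_nonneg_right (kinetic_nonneg _ _)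
  have hk₂ : kinetic c.s w.2 ≤ κ := le_add_of_nonneg_left (kinetic_nonneg _ _)
  have b₁ : selfEnergy₁ c w ≤ c.μ₁ / c.p * (C₁ * κ ^ (e₁ / (2 * c.s))) :=
    mul_le_mul_of_nonneg_left ((h₁ _ hw.1.1.1).2 κ hκpos hk₁) (by positivity)
  have b₂ : selfEnergy₂ c w ≤ c.μ₂ / c.q * (C₂ * κ ^ (e₂ / (2 * c.s))) :=
    mul_le_mul_of_nonneg_left ((h₂ _ hw.1.1.2).2 κ hκpos hk₂) (by positivity)
  have b₃ : mixedEnergy c w ≤ c.β * ((C₃ + C₄) * κ ^ (e₃ / (2 * c.s))) := by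
    refine mul_le_mul_of_nonneg_left ((integral_mul_rpow_le hc.r₁_pos hc.r₂_pos
      (h₃ _ hw.1.1.1).1 (h₄ _ hw.1.1.2).1).trans ?_) hβ.le
    rw [add_mul]
    exact add_le_add ((h₃ _ hw.1.1.1).2 κ hκpos hk₁) ((h₄ _ hw.1.1.2).2 κ hκpos hk₂)
  have hP := hw.2
  rw [pohozaev_eq] at hP
  have m₁ := mul_le_mul_of_nonneg_left b₁ (by linarith : 0 ≤ e₁)
  have m₂ := mul_le_mul_of_nonneg_left b₂ (by linarith : 0 ≤ e₂)
  have m₃ := mul_le_mul_of_nonneg_left b₃ (by linarith : 0 ≤ e₃)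
  have hsp : ∀ e : ℝ, κ ^ (e / (2 * c.s)) = κ ^ (e / (2 * c.s) - 1) * κ := fun e => by
    rw [Real.rpow_sub_one hκpos.ne', div_mul_cancel₀ _ hκpos.ne']
  rw [hsp] at m₁ m₂ m₃
  have hfin : c.s * κ ≤ G κ * κ := by
    have : G κ * κ = e₁ * (c.μ₁ / c.p * (C₁ * (κ ^ (e₁ / (2 * c.s) - 1) * κ)))
        + e₂ * (c.μ₂ / c.q * (C₂ * (κ ^ (e₂ / (2 * c.s) - 1) * κ)))
        + e₃ * (c.β * ((C₃ + C₄) * (κ ^ (e₃ / (2 * c.s) - 1) * κ))) := by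
      simp only [hG, D₁, D₂, D₃]; ring
    rw [this]; linarith
  linarith [le_of_mul_le_mul_right hfin hκpos]

/-- With `m` the least scaling exponent, `P = 0` bounds the total interaction energy by `(s/m) K`.
Hence `J ≥ (1/2 - s/m) K`, and `m > 2s` makes the factor positive. -/
theorem exists_le_energy (hc : Admissible c) (ha : 0 < a) (hb : 0 < b) :
    ∃ ε > 0, ∀ w ∈ pohozaevSet c a b, ε ≤ energy c w := by
  obtain ⟨δ, hδ, h⟩ := hc.exists_le_pairKinetic ha hb
  have hs := hc.s_pos
  have he₁ := two_mul_lt_fiberExp hs hc.lt_p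
  have he₂ := two_mul_lt_fiberExp hs hc.lt_q
  have he₃ := two_mul_lt_fiberExp hs hc.lt_r
  set m := min (fiberExp c.s c.p) (min (fiberExp c.s c.q) (fiberExp c.s (c.r₁ + c.r₂))) with hm
  have hm0 : 2 * c.s < m := lt_min he₁ (lt_min he₂ he₃)
  have hfac : 0 < 1 / 2 - c.s / m := by
    rw [sub_pos, div_lt_div_iff₀ (by linarith) two_pos]; linarith
  refine ⟨(1 / 2 - c.s / m) * δ, by positivity, fun w hw => ?_⟩
  have hP := hw.2
  rw [pohozaev_eq] at hP
  have b₁ := mul_le_mul_of_nonneg_right (min_le_left _ _ : m ≤ fiberExp c.s c.p)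
    (hc.selfEnergy₁_nonneg w)
  have b₂ := mul_le_mul_of_nonneg_right
    ((min_le_right _ _).trans (min_le_left _ _) : m ≤ fiberExp c.s c.q) (hc.selfEnergy₂_nonneg w)
  have b₃ := mul_le_mul_of_nonneg_right
    ((min_le_right _ _).trans (min_le_right _ _) : m ≤ fiberExp c.s (c.r₁ + c.r₂))
    (hc.mixedEnergy_nonneg w)
  have hA : selfEnergy₁ c w + selfEnergy₂ c w + mixedEnergy c w ≤ c.s / m * pairKinetic c w := by
    rw [div_mul_eq_mul_div, le_div_iff₀ (by linarith)]; linarith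
  have hk := mul_le_mul_of_nonneg_left (h w hw) hfac.le
  rw [energy_eq]
  linarith

end Admissible

end MixedSchrodinger

end

open MixedSchrodinger in
/-- The first conjunct says that the maxima over `t > 0` are attained, the next two that both
infima are taken over nonempty sets that are bounded below. -/
theorem corollary3p8 (c : Coeffs)
    (hs : 1 / 2 < c.s) (hs' : c.s < 1)
    (hμ₁ : 0 < c.μ₁) (hμ₂ : 0 < c.μ₂) (hβ : 0 < c.β)
    (hr₁ : 1 < c.r₁) (hr₂ : 1 < c.r₂)
    (hp : 2 * (1 + 3 * c.s) / (1 + c.s) < c.p) (hp' : c.p < 2 * (1 + c.s) / (1 - c.s))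
    (hq : 2 * (1 + 3 * c.s) / (1 + c.s) < c.q) (hq' : c.q < 2 * (1 + c.s) / (1 - c.s))
    (hr : 2 * (1 + 3 * c.s) / (1 + c.s) < c.r₁ + c.r₂)
    (hr' : c.r₁ + c.r₂ < 2 * (1 + c.s) / (1 - c.s))
    (a b : ℝ) (ha : 0 < a) (hb : 0 < b) :
    (∀ w ∈ nonzeroPairs c.s a b,
        IsGreatest (fiberEnergy c w '' Set.Ioi 0) (fiberMax c w)) ∧
      IsGLB (energy c '' pohozaevSet c a b) (groundLevel c a b) ∧
      IsGLB (fiberMax c '' nonzeroPairs c.s a b)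
        (sInf (fiberMax c '' nonzeroPairs c.s a b)) ∧
      groundLevel c a b = sInf (fiberMax c '' nonzeroPairs c.s a b) ∧
      0 < groundLevel c a b := by
  have hc : Admissible c := ⟨by linarith, hs', hμ₁, hμ₂, hβ, by linarith, by linarith,
    hp, hp', hq, hq', hr, hr'⟩
  obtain ⟨ε, hε, hle⟩ := hc.exists_le_energy ha hb
  have hne : (energy c '' pohozaevSet c a b).Nonempty := by
    rw [← hc.image_fiberMax_eq ha hb]
    exact (nonzeroPairs_nonempty hc.s_pos hc.s_lt ha hb).image _
  have hlow : ε ∈ lowerBounds (energy c '' pohozaevSet c a b) := by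
    rintro _ ⟨w, hw, rfl⟩
    exact hle w hw
  -- Both infima now range over the same set, so their equality is definitional.
  rw [hc.image_fiberMax_eq ha hb]
  refine ⟨fun w hw => ?_, isGLB_csInf hne ⟨ε, hlow⟩, isGLB_csInf hne ⟨ε, hlow⟩, rfl,
    lt_of_lt_of_le hε (le_csInf hne hlow)⟩
  obtain ⟨t, ht, hmem, hmax⟩ := hc.exists_isGreatest ha hb hw
  rwa [fiberMax, hmax.csSup_eq]
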